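/- Let $R$ be a commutative ring containing $\mathbb Q$, let $n\ge 1$, and let $F=(F_i)_{1\le i\le n}$ be formal power series in $R[[X_1,\dots,X_n]]$ without constant term, written $F_i(X)=\sum_{d\ge1}\frac1{d!}\sum_{j_1,\dots,j_d}F^{[d]}_{i,j_1\dots j_d}X_{j_1}\cdots X_{j_d}$ with coefficients symmetric in $j_1,\dots,j_d$. Put $A=(F^{[1]}_{i,j})_{i,j}$, assume $A\in GL_n(R)$, and let $H_i$ be minus the sum of the terms of degree $\ge2$ of $F_i$, so that $F_i(X)=\sum_jA_{ij}X_j-H_i(X)$ and $H^{[p]}=-F^{[p]}$ for $p\ge 2$. *Formal Gaussian integral.* Let $\bar u,u,Y$ be vectors of $n$ indeterminates. For $U=\sum c_{\alpha_1,\alpha_2,\alpha_3}\bar u^{\alpha_1}u^{\alpha_2}Y^{\alpha_3}\in R[[\bar u,u,Y]]$ set $$\int d\bar u\,du\,e^{-\bar uAu}\,U=\sum_{\alpha_1,\alpha_2,\alpha_3}c_{\alpha_1,\alpha_2,\alpha_3}Y^{\alpha_3}(\det A)^{-1}\sum_{\sigma}\prod_{k}(A^{-1})_{\tau_2(\sigma(k))\,\tau_1(k)}\in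 R[[Y]],$$ where $\tau_r:[|\alpha_r|]\to[n]$ is any map taking each value $j$ exactly $(\alpha_r)_j$ times and $\sigma$ runs over the bijections $[|\alpha_1|]\to[|\alpha_2|]$; the integral is defined if for every $\alpha_3$ only finitely many $(\alpha_1,\alpha_2)$ contribute a nonzero term. Write $\bar uH(u)=\sum_i\bar u_iH_i(u)$ and $\bar uY=\sum_i\bar u_iY_i$. *Diagrams.* Let $I,J$ be finite sets. A Feynman diagram structure $\mathcal F$ of type $(I,J)$ on a finite set $E$ consists of decompositions $E=E_u\sqcup E_{\bar u}=E_{int}\sqcup E_{ext}$, bijections $\rho_u:I\to E_{ext}\cap E_u$ and $\rho_{\bar u}:J\to E_{ext}\cap E_{\bar u}$, disjoint sets $\pi_H,\pi_Y$ of subsets of $E$ whose union is a partition of $E_{int}$, such that each $B\in\pi_H$ ($H$-vertex) has exactly one element in $E_{\bar u}$ and at least two in $E_u$ and each $B\in\pi_Y$ ($Y$-vertex) is a single element of $E_{\bar u}$, and a bijection $\mathcal C:E_{\bar u}\to E_u$. Its digraph has as vertices the $H$-vertices, the $Y$-vertices and the singletons of $E_{ext}\cap E_u$ ($u$-sources)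 and of $E_{ext}\cap E_{\bar u}$ ($\bar u$-sources), with a link from $a$ to $b$ when $\mathcal C(x)\in b$ for some $x\in a\cap E_{\bar u}$. The diagram is connected if this digraph has a vertex and its underlying undirected graph is connected. It is tree-like if the digraph is a tree with all links oriented towards a root which is the unique $u$-source, whose leaves (vertices at which no link ends) are $Y$-vertices or $\bar u$-sources, and whose other non-root vertices are $H$-vertices at each of which at least two links end. Given $\tau_u:I\to[n]$ and $\tau_{\bar u}:J\to[n]$, the amplitude is $$\mathcal A(E,\mathcal F)=\sum_{\alpha}\prod_{x\in E_{\bar u}}(A^{-1})_{\alpha(\mathcal C(x))\,\alpha(x)}\prod_{B\in\pi_H}H^{[p]}_{\alpha(\bar x),\alpha(y_1)\dots\alpha(y_p)}\prod_{\{\bar x\}\in\pi_Y}Y_{\alpha(\bar x)}\in R[[Y]],$$ over all $\alpha:E\to[n]$ with $\alpha\circ\rho_u=\tau_u$ and $\alpha\circ\rho_{\bar u}=\tau_{\bar u}$, where $B\cap E_{\bar u}=\{\bar x\}$ and $B\cap E_u=\{y_1,\dots,y_p\}$ for $B\in\pi_H$. Isomorphisms are bijections $E\to E'$ transporting one structure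 to the other, and $\mathrm{Aut}(E,\mathcal F)$ is the resulting automorphism group. For $i\in[n]$ put $$\langle u_i\rangle_C=\sum_{[E,\mathcal F]}\frac{\mathcal A(E,\mathcal F)}{\#\mathrm{Aut}(E,\mathcal F)},$$ the sum over isomorphism classes of connected Feynman diagrams of type $([1],\emptyset)$, with $\tau_u(1)=i$. **Corollary 1.** For every $i\in[n]$ the two formal Gaussian integrals below are defined, the denominator is invertible in $R[[Y]]$, the sum defining $\langle u_i\rangle_C$ is summable in $R[[Y]]$ (each coefficient receives finitely many nonzero contributions), and $$\frac{\int d\bar u\,du\;e^{-\bar uAu}\,u_i\,e^{\bar uH(u)+\bar uY}}{\int d\bar u\,du\;e^{-\bar uAu}\,e^{\bar uH(u)+\bar uY}}=\langle u_i\rangle_C .$$ Moreover every connected Feynman diagram of type $([1],\emptyset)$ is tree-like, and all its leaves are $Y$-vertices. -/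

import Mathlib

open Finset

noncomputable section

namespace FeynRev

/-! ### Power series: tensor coefficients, linear and nonlinear parts, summable families -/

/-- The multiplicity multiindex `μ(τ)` of a finite family of indices `τ : K → [n]`. -/
def mult {n : ℕ} {K : Type*} [Fintype K] (τ : K → Fin n) : Fin n →₀ ℕ :=
  ∑ k, Finsupp.single (τ k) 1

/-- The tensor element `f^{[d]}_{j₁…j_d} = ∂^d f / ∂X_{j₁}…∂X_{j_d} (0)`, which depends only on the
multiplicity multiindex `m = μ(j₁,…,j_d)`: it is `m!` times the coefficient of `X^m` in `f`. -/
def tensorCoeff {n : ℕ} {R : Type*} [CommRing R] (f : MvPowerSeries (Fin n) R)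
    (m : Fin n →₀ ℕ) : R :=
  (∏ j, ((m j).factorial : R)) * MvPowerSeries.coeff m f

/-- The matrix `A = (F^{[1]}_{i,j})` of the linear part of `F`. -/
def linMatrix {n : ℕ} {R : Type*} [CommRing R] (F : Fin n → MvPowerSeries (Fin n) R) :
    Matrix (Fin n) (Fin n) R :=
  Matrix.of fun i j => tensorCoeff (F i) (Finsupp.single j 1)

/-- The series `H_i`, minus the sum of the terms of degree at least `2` of `F_i`. -/
def nonlin {n : ℕ} {R : Type*} [CommRing R] (F : Fin n → MvPowerSeries (Fin n) R) (i : Fin n) :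
    MvPowerSeries (Fin n) R :=
  fun m => if 2 ≤ m.degree then -MvPowerSeries.coeff m (F i) else 0

/-- Summability of a family of formal power series, the ring of coefficients being discrete:
every coefficient receives finitely many nonzero contributions. -/
def SummableFamily {σ R ι : Type*} [CommRing R] (f : ι → MvPowerSeries σ R) : Prop :=
  ∀ d : σ →₀ ℕ, {k : ι | MvPowerSeries.coeff d (f k) ≠ 0}.Finite

/-- The sum of a summable family of formal power series. -/
def familySum {σ R ι : Type*} [CommRing R] (f : ι → MvPowerSeries σ R) : MvPowerSeries σ R :=
  fun d => ∑ᶠ k, MvPowerSeries.coeff d (f k)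

/-! ### Formal Gaussian integration -/

/-- The `3n` indeterminates `ū₁,…,ūₙ`, `u₁,…,uₙ`, `Y₁,…,Yₙ`. -/
abbrev FieldVar (n : ℕ) : Type := Fin n ⊕ Fin n ⊕ Fin n

/-- The index of `ū_i`. -/
abbrev ubarVar {n : ℕ} (i : Fin n) : FieldVar n := Sum.inl i

/-- The index of `u_i`. -/
abbrev uVar {n : ℕ} (i : Fin n) : FieldVar n := Sum.inr (Sum.inl i)

/-- The index of `Y_i`. -/
abbrev yVar {n : ℕ} (i : Fin n) : FieldVar n := Sum.inr (Sum.inr i)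

/-- `I_A(τ₁,τ₂) = ∑_σ ∏_k (A⁻¹)_{τ₂(σ(k)) τ₁(k)}`, the sum over all bijections `σ : K₁ → K₂`. -/
def wickSum {n : ℕ} {R : Type*} [CommRing R] (A : Matrix (Fin n) (Fin n) R)
    {K₁ K₂ : Type*} [Fintype K₁] [DecidableEq K₁] [Fintype K₂] [DecidableEq K₂]
    (τ₁ : K₁ → Fin n) (τ₂ : K₂ → Fin n) : R :=
  ∑ σ : K₁ ≃ K₂, ∏ k, A⁻¹ (τ₂ (σ k)) (τ₁ k)

/-- The formal Gaussian integral of the monomial `ū^{α₁} u^{α₂}`, computed with the index maps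
`Sigma.fst : (Σ j, Fin (α j)) → [n]`, whose multiplicity multiindex is `α`. -/
def gaussMonomial {n : ℕ} {R : Type*} [CommRing R] (A : Matrix (Fin n) (Fin n) R)
    (α₁ α₂ : Fin n → ℕ) : R :=
  Ring.inverse A.det *
    wickSum A (Sigma.fst : (Σ j, Fin (α₁ j)) → Fin n) (Sigma.fst : (Σ j, Fin (α₂ j)) → Fin n)

theorem mult_apply {n : ℕ} {K : Type*} [Fintype K] (τ : K → Fin n) (j : Fin n) :
    mult τ j = Fintype.card {k // τ k = j} := by
  classical
  simp [mult, Finsupp.finsetSum_apply, Finsupp.single_apply, Fintype.card_subtype]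

theorem exists_equiv_of_mult {n : ℕ} {K : Type*} [Fintype K] (τ : K → Fin n) (α : Fin n → ℕ)
    (h : ∀ j, mult τ j = α j) : ∃ e : (Σ j, Fin (α j)) ≃ K, ∀ x, τ (e x) = x.1 := by
  classical
  have e : ∀ j, Fin (α j) ≃ {k // τ k = j} := fun j =>
    Fintype.equivOfCardEq (by rw [← mult_apply, h j, Fintype.card_fin])
  refine ⟨(Equiv.sigmaCongrRight e).trans (Equiv.sigmaFiberEquiv τ), fun x => ?_⟩
  exact (e x.1 x.2).2

/-- Any index maps with the right multiplicities compute the same integral. -/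
theorem gaussMonomial_eq {n : ℕ} {R : Type*} [CommRing R] (A : Matrix (Fin n) (Fin n) R)
    (α₁ α₂ : Fin n → ℕ) {K₁ K₂ : Type*} [Fintype K₁] [DecidableEq K₁] [Fintype K₂]
    [DecidableEq K₂] (τ₁ : K₁ → Fin n) (τ₂ : K₂ → Fin n)
    (h₁ : ∀ j, mult τ₁ j = α₁ j) (h₂ : ∀ j, mult τ₂ j = α₂ j) :
    gaussMonomial A α₁ α₂ = Ring.inverse A.det * wickSum A τ₁ τ₂ := by
  obtain ⟨e₁, he₁⟩ := exists_equiv_of_mult τ₁ α₁ h₁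
  obtain ⟨e₂, he₂⟩ := exists_equiv_of_mult τ₂ α₂ h₂
  unfold gaussMonomial wickSum
  congr 1
  refine Fintype.sum_equiv (Equiv.equivCongr e₁ e₂) _ _ fun σ => ?_
  refine Fintype.prod_equiv e₁ _ _ fun x => ?_
  simp [he₁, he₂]

/-- The terms of the formal Gaussian integral of `U ∈ R[[ū,u,Y]]`, one for each monomial
`ū^{α₁} u^{α₂} Y^{α₃}`, as elements of `R[[Y]]`. -/
def gaussTerm {n : ℕ} {R : Type*} [CommRing R] (A : Matrix (Fin n) (Fin n) R)
    (U : MvPowerSeries (FieldVar n) R) (d : FieldVar n →₀ ℕ) : MvPowerSeries (Fin n) R :=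
  MvPowerSeries.monomial (Finsupp.equivFunOnFinite.symm fun j => d (yVar j))
    (MvPowerSeries.coeff d U * gaussMonomial A (fun j => d (ubarVar j)) (fun j => d (uVar j)))

/-- The formal Gaussian integral of `U` is defined. -/
def GaussIntegrable {n : ℕ} {R : Type*} [CommRing R] (A : Matrix (Fin n) (Fin n) R)
    (U : MvPowerSeries (FieldVar n) R) : Prop :=
  SummableFamily (gaussTerm A U)

/-- The formal Gaussian integral `∫ dū du e^{-ūAu} U ∈ R[[Y]]`. -/
def gaussIntegral {n : ℕ} {R : Type*} [CommRing R] (A : Matrix (Fin n) (Fin n) R)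
    (U : MvPowerSeries (FieldVar n) R) : MvPowerSeries (Fin n) R :=
  familySum (gaussTerm A U)

/-- The interaction `ūH(u) + ūY`. -/
def interaction {n : ℕ} {R : Type*} [CommRing R] (F : Fin n → MvPowerSeries (Fin n) R) :
    MvPowerSeries (FieldVar n) R :=
  ∑ i, MvPowerSeries.X (ubarVar i) * MvPowerSeries.rename uVar (nonlin F i) +
    ∑ i, MvPowerSeries.X (ubarVar i) * MvPowerSeries.X (yVar i)

/-- The series `exp(ūH(u) + ūY)`. -/
def expInteraction {n : ℕ} {R : Type*} [CommRing R] [Algebra ℚ R]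
    (F : Fin n → MvPowerSeries (Fin n) R) : MvPowerSeries (FieldVar n) R :=
  (PowerSeries.exp R).subst (interaction F)

/-! ### Feynman diagrams -/

/-- A pre-Feynman diagram structure of type `(I,J)` on the finite set `E`. -/
structure PreFeynman (I J E : Type*) [Fintype E] [DecidableEq E] where
  Eubar : Finset E
  Eu : Finset E
  Eint : Finset E
  Eext : Finset E
  piH : Finset (Finset E)
  piY : Finset (Finset E)
  rhoU : I → E
  rhoUbar : J → E
  isCompl_u_ubar : IsCompl Eu Eubar
  isCompl_int_ext : IsCompl Eint Eext
  bijOn_rhoU : Set.BijOn rhoU Set.univ (Eext ∩ Eu : Finset E)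
  bijOn_rhoUbar : Set.BijOn rhoUbar Set.univ (Eext ∩ Eubar : Finset E)
  disjoint_H_Y : Disjoint piH piY
  partition_int : ∃ P : Finpartition Eint, P.parts = piH ∪ piY
  H_vertex : ∀ B ∈ piH, (B ∩ Eubar).card = 1 ∧ 2 ≤ (B ∩ Eu).card
  Y_vertex : ∀ B ∈ piY, (B ∩ Eubar).card = 1 ∧ B ∩ Eu = ∅

/-- A Feynman diagram structure of type `(I,J)` on `E`: a pre-Feynman diagram structure with a
contraction scheme, a bijection from `E_ū` to `E_u`. -/
structure Feynman (I J E : Type*) [Fintype E] [DecidableEq E] extends PreFeynman I J E where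
  contr : {x // x ∈ Eubar} ≃ {x // x ∈ Eu}

namespace Feynman

section Iso

variable {I J E E' E'' : Type*} [Fintype E] [DecidableEq E] [Fintype E'] [DecidableEq E']
  [Fintype E''] [DecidableEq E'']

/-- The bijection `σ : E → E'` transports the Feynman diagram structure `D` on `E` to the
structure `D'` on `E'`. -/
structure IsIso (D : Feynman I J E) (D' : Feynman I J E') (σ : E ≃ E') : Prop where
  Eubar : D'.Eubar = D.Eubar.map σ.toEmbedding
  Eu : D'.Eu = D.Eu.map σ.toEmbedding
  Eint : D'.Eint = D.Eint.map σ.toEmbedding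
  Eext : D'.Eext = D.Eext.map σ.toEmbedding
  piH : D'.piH = D.piH.map σ.finsetCongr.toEmbedding
  piY : D'.piY = D.piY.map σ.finsetCongr.toEmbedding
  rhoU : D'.rhoU = σ ∘ D.rhoU
  rhoUbar : D'.rhoUbar = σ ∘ D.rhoUbar
  contr : ∀ (x : {x // x ∈ D.Eubar}) (y : {y // y ∈ D'.Eubar}), σ x = y →
    (D'.contr y : E') = σ (D.contr x)

/-- The cardinal of the automorphism group of a Feynman diagram. -/
def autCard (D : Feynman I J E) : ℕ := Nat.card {σ : E ≃ E // D.IsIso D σ}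

theorem IsIso.refl (D : Feynman I J E) : D.IsIso D (Equiv.refl E) := by
  constructor <;> try (ext; simp)
  intro x y h
  obtain rfl : x = y := Subtype.ext h
  rfl

theorem IsIso.symm {D : Feynman I J E} {D' : Feynman I J E'} {σ : E ≃ E'}
    (h : D.IsIso D' σ) : D'.IsIso D σ.symm := by
  constructor
  · rw [h.Eubar]; ext; simp
  · rw [h.Eu]; ext; simp
  · rw [h.Eint]; ext; simp
  · rw [h.Eext]; ext; simp
  · rw [h.piH, Finset.map_map]; ext; simp [Finset.map_map]
  · rw [h.piY, Finset.map_map]; ext; simp [Finset.map_map]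
  · rw [h.rhoU]; ext; simp
  · rw [h.rhoUbar]; ext; simp
  · intro x y hxy
    rw [h.contr y x (by rw [← hxy]; simp)]
    simp

theorem IsIso.trans {D : Feynman I J E} {D' : Feynman I J E'} {D'' : Feynman I J E''}
    {σ : E ≃ E'} {σ' : E' ≃ E''} (h : D.IsIso D' σ) (h' : D'.IsIso D'' σ') :
    D.IsIso D'' (σ.trans σ') := by
  constructor
  · rw [h'.Eubar, h.Eubar, Finset.map_map]; rfl
  · rw [h'.Eu, h.Eu, Finset.map_map]; rfl
  · rw [h'.Eint, h.Eint, Finset.map_map]; rfl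
  · rw [h'.Eext, h.Eext, Finset.map_map]; rfl
  · rw [h'.piH, h.piH, Finset.map_map]
    congr 1; ext s x; simp [Finset.mem_map_equiv, ← Equiv.eq_symm_apply]
  · rw [h'.piY, h.piY, Finset.map_map]
    congr 1; ext s x; simp [Finset.mem_map_equiv, ← Equiv.eq_symm_apply]
  · rw [h'.rhoU, h.rhoU]; rfl
  · rw [h'.rhoUbar, h.rhoUbar]; rfl
  · intro x y hxy
    have hx : σ x ∈ D'.Eubar := by rw [h.Eubar]; simp
    rw [h'.contr ⟨σ x, hx⟩ y hxy, h.contr x ⟨σ x, hx⟩ rfl]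
    rfl

theorem IsIso.autCard_eq {D : Feynman I J E} {D' : Feynman I J E'} {σ : E ≃ E'}
    (h : D.IsIso D' σ) : D.autCard = D'.autCard := by
  refine Nat.card_congr
    { toFun := fun s => ⟨(σ.symm.trans s.1).trans σ, (h.symm.trans s.2).trans h⟩
      invFun := fun s => ⟨(σ.trans s.1).trans σ.symm, (h.trans s.2).trans h.symm⟩
      left_inv := fun s => by ext; simp
      right_inv := fun s => by ext; simp }

end Iso

section Amplitude

variable {I J E E' : Type*} [Fintype E] [DecidableEq E] [Fintype E'] [DecidableEq E']
  {n : ℕ} {R : Type*} [CommRing R]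

/-- The contribution `H(B,α) = H^{[p]}_{α(x̄),α(y₁)…α(y_p)}` of an `H`-vertex `B`, where
`B ∩ E_ū = {x̄}` and `B ∩ E_u = {y₁,…,y_p}` (the product has this single factor). -/
def hVertex (F : Fin n → MvPowerSeries (Fin n) R) (D : Feynman I J E) (α : E → Fin n)
    (B : Finset E) : R :=
  ∏ x ∈ B ∩ D.Eubar, tensorCoeff (nonlin F (α x)) (∑ y ∈ B ∩ D.Eu, Finsupp.single (α y) 1)

/-- The contribution `Y(B,α) = Y_{α(x̄)}` of a `Y`-vertex `B = {x̄}`. -/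
def yVertex (R : Type*) [CommRing R] (D : Feynman I J E) (α : E → Fin n)
    (B : Finset E) : MvPowerSeries (Fin n) R :=
  ∏ x ∈ B ∩ D.Eubar, MvPowerSeries.X (α x)

/-- Index attributions compatible with the index assignments of the external half-lines. -/
def IsAttribution (D : Feynman I J E) (τu : I → Fin n) (τubar : J → Fin n)
    (α : E → Fin n) : Prop :=
  (∀ i, α (D.rhoU i) = τu i) ∧ ∀ j, α (D.rhoUbar j) = τubar j

open Classical in
/-- The amplitude of a Feynman diagram in `R[[Y]]`, with propagators `(A⁻¹)_{α(𝒞(x̄)) α(x̄)}`. -/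
def amplitude (F : Fin n → MvPowerSeries (Fin n) R) (D : Feynman I J E)
    (τu : I → Fin n) (τubar : J → Fin n) : MvPowerSeries (Fin n) R :=
  ∑ α : E → Fin n with D.IsAttribution τu τubar α,
    (∏ x : {x // x ∈ D.Eubar}, MvPowerSeries.C ((linMatrix F)⁻¹ (α (D.contr x)) (α x))) *
      (∏ B ∈ D.piH, MvPowerSeries.C (D.hVertex F α B)) * ∏ B ∈ D.piY, D.yVertex R α B

theorem IsIso.amplitude_eq {D : Feynman I J E} {D' : Feynman I J E'} {σ : E ≃ E'}
    (h : D.IsIso D' σ) (F : Fin n → MvPowerSeries (Fin n) R) (τu : I → Fin n)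
    (τubar : J → Fin n) : D.amplitude F τu τubar = D'.amplitude F τu τubar := by
  classical
  unfold amplitude
  refine Finset.sum_equiv (Equiv.arrowCongr σ (Equiv.refl _)) ?_ ?_
  · intro α
    rw [Finset.mem_filter, Finset.mem_filter]
    simp [IsAttribution, h.rhoU, h.rhoUbar]
  · intro α _
    congr 1
    · congr 1
      · refine Fintype.prod_equiv (σ.subtypeEquiv (by intro a; rw [h.Eubar]; simp)) _ _ ?_
        intro x
        rw [h.contr x (σ.subtypeEquiv _ x) rfl]
        simp
      · rw [h.piH, Finset.prod_map]
        refine Finset.prod_congr rfl fun B _ => ?_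
        simp [hVertex, h.Eubar, h.Eu, ← Finset.map_inter]
    · rw [h.piY, Finset.prod_map]
      refine Finset.prod_congr rfl fun B _ => ?_
      simp [yVertex, h.Eubar, ← Finset.map_inter]

end Amplitude

/-! ### The digraph of a Feynman diagram, connectedness, tree-likeness -/

section Graph

variable {I J E : Type*} [Fintype E] [DecidableEq E]

/-- The `u`-sources, as one-element subsets of `E`. -/
def uSources (D : Feynman I J E) : Finset (Finset E) := (D.Eext ∩ D.Eu).image fun x => {x}

/-- The `ū`-sources, as one-element subsets of `E`. -/
def ubarSources (D : Feynman I J E) : Finset (Finset E) := (D.Eext ∩ D.Eubar).image fun x => {x}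

/-- The vertex set `Ẽ`: sources, `H`-vertices and `Y`-vertices. -/
abbrev Vertex (D : Feynman I J E) : Type _ :=
  {a : Finset E // a ∈ D.uSources ∪ D.ubarSources ∪ D.piH ∪ D.piY}

/-- The digraph `G` on `Ẽ`: a link goes from `a` to `b` if some `x ∈ a ∩ E_ū` is contracted with
an element of `b ∩ E_u`. -/
def digraph (D : Feynman I J E) : Digraph D.Vertex where
  Adj a b := ∃ x : {x // x ∈ D.Eubar}, (x : E) ∈ a.1 ∧ (D.contr x : E) ∈ b.1

/-- The underlying undirected graph of the digraph `G`. -/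
def graph (D : Feynman I J E) : SimpleGraph D.Vertex := D.digraph.toSimpleGraphInclusive

/-- Connected Feynman diagrams: `G` connects `Ẽ`, which is nonempty. -/
def Connected (D : Feynman I J E) : Prop := D.graph.Connected

/-- Tree-like connected Feynman diagrams: `G` is a tree with all links oriented towards the root,
which is the unique `u`-source; the leaves are `Y`-vertices or `ū`-sources; the internal vertices
are `H`-vertices and have at least two offsprings. -/
def TreeLike (D : Feynman I J E) : Prop :=
  ∃ r : D.Vertex,
    (∀ a : D.Vertex, a.1 ∈ D.uSources ↔ a = r) ∧
    D.graph.IsTree ∧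
    (∀ a b, D.digraph.Adj a b → D.graph.dist a r = D.graph.dist b r + 1) ∧
    (∀ a, a ≠ r → (∀ b, ¬ D.digraph.Adj b a) → a.1 ∈ D.piY ∪ D.ubarSources) ∧
    (∀ a, a ≠ r → (∃ b, D.digraph.Adj b a) →
      a.1 ∈ D.piH ∧ ∃ b b', b ≠ b' ∧ D.digraph.Adj b a ∧ D.digraph.Adj b' a)

/-- All leaves (vertices at which no link ends) are `Y`-vertices. -/
def LeavesAreY (D : Feynman I J E) : Prop :=
  ∀ a : D.Vertex, (∀ b, ¬ D.digraph.Adj b a) → a.1 ∈ D.piY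

end Graph

end Feynman

/-! ### Connected correlation functions -/

/-- Connected Feynman diagrams of type `(I,J)` on the standard finite sets. -/
abbrev ConnDiagram (I J : Type*) : Type _ := Σ m : ℕ, {D : Feynman I J (Fin m) // D.Connected}

/-- Isomorphism of connected Feynman diagrams. -/
instance connSetoid (I J : Type*) : Setoid (ConnDiagram I J) where
  r D D' := ∃ σ : Fin D.1 ≃ Fin D'.1, D.2.1.IsIso D'.2.1 σ
  iseqv :=
    { refl := fun D => ⟨_, Feynman.IsIso.refl D.2.1⟩
      symm := fun ⟨_, h⟩ => ⟨_, h.symm⟩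
      trans := fun ⟨_, h⟩ ⟨_, h'⟩ => ⟨_, h.trans h'⟩ }

/-- Isomorphism classes `[E,𝓕]` of connected Feynman diagrams of type `(I,J)`; every finite set `E`
being in bijection with some `Fin m`, each class has representatives on the latter. -/
abbrev ConnClass (I J : Type*) : Type _ := Quotient (connSetoid I J)

/-- The contribution `𝓐(E,𝓕) / #Aut(E,𝓕)` of a class of connected diagrams. -/
def connTerm {n : ℕ} {R : Type*} [CommRing R] [Algebra ℚ R] {I J : Type*}
    (F : Fin n → MvPowerSeries (Fin n) R) (τu : I → Fin n) (τubar : J → Fin n) :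
    ConnClass I J → MvPowerSeries (Fin n) R :=
  Quotient.lift
    (fun D : ConnDiagram I J => (D.2.1.autCard : ℚ)⁻¹ • D.2.1.amplitude F τu τubar)
    (by
      rintro D D' ⟨σ, h⟩
      simp only [h.autCard_eq, h.amplitude_eq])

/-- The connected correlation function `⟨∏ u_{τ_u(i)} ∏ ū_{τ_ū(j)}⟩_C`. -/
def connCorrelation {n : ℕ} {R : Type*} [CommRing R] [Algebra ℚ R] {I J : Type*}
    (F : Fin n → MvPowerSeries (Fin n) R) (τu : I → Fin n) (τubar : J → Fin n) :
    MvPowerSeries (Fin n) R :=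
  familySum (connTerm F τu τubar)

end FeynRev

end

/-!
Write `⟨u^m⟩` for the Gaussian integral of `u^m e^{ūH(u)+ūY}`. Integration by parts in the `ū_l`
gives the Schwinger–Dyson equations `⟨u_i u^m⟩ = ∑_l (A⁻¹)_{il} (Y_l ⟨u^m⟩ + ⟨H_l(u) u^m⟩)`.
Because `H` starts in degree two and `⟨u^m⟩` has order at least `|m|` in `Y`, their solution is
determined by `⟨1⟩`. If `G` solves the fixed point equation `G = A⁻¹ (Y + H(G))`, then
`m ↦ G^m ⟨1⟩` is a solution as well, so `⟨u_i⟩ = G_i ⟨1⟩`.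

Iterating the fixed point equation expands `G` as a sum over planar trees, a vertex with `d`
children contributing `1/d!`. A connected diagram `D` is the same as a rooted tree, given by its
parent map, in which no vertex has exactly one child. An isomorphism from a planar tree to `D` is
the choice of an ordering of the children of each vertex of `D`; there are `d!` orderings at a
vertex with `d` children, so the isomorphisms from all planar trees to `D`, each counted with the
weight of its planar tree, add up to `1`. A planar tree isomorphic to `D` has the amplitude of `D`
and `#Aut D` isomorphisms to it, hence these planar trees have total weight `1 / #Aut D`.
-/

noncomputable section

namespace FeynRev

open MvPowerSeries

open scoped MvPowerSeries.WithPiTopology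

/-! ### Summation and substitution of power series -/

section PowerSeries

instance nonarchimedeanRing_of_isLinearTopology {T : Type*} [CommRing T] [TopologicalSpace T]
    [IsTopologicalRing T] [IsLinearTopology T T] : NonarchimedeanRing T where
  is_nonarchimedean U hU := by
    obtain ⟨I, hI, hIU⟩ := (IsLinearTopology.hasBasis_open_ideal (R := T)).mem_iff.1 hU
    exact ⟨⟨I.toAddSubgroup, hI⟩, hIU⟩

theorem hasSum_prod_pi {T ι : Type*} [CommRing T] [UniformSpace T] [IsUniformAddGroup T]
    [NonarchimedeanRing T] {d : ℕ} {f : Fin d → ι → T} {a : Fin d → T}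
    (hf : ∀ k, HasSum (f k) (a k)) :
    HasSum (fun c : Fin d → ι => ∏ k, f k (c k)) (∏ k, a k) := by
  induction d with
  | zero => simp
  | succ d ih =>
    have hmul := (hf 0).mul_of_nonarchimedean (ih fun k => hf k.succ)
    rw [Fin.prod_univ_succ, ← (Fin.consEquiv fun _ => ι).hasSum_iff]
    refine hmul.congr_fun fun p => ?_
    simp [Fin.prod_univ_succ, Fin.consEquiv]

theorem hasSum_comp_add_right_iff {σ T : Type*} [AddCommMonoid T] [TopologicalSpace T]
    {f : (σ →₀ ℕ) → T} {a : T} {e : σ →₀ ℕ} (hf : ∀ d, ¬ e ≤ d → f d = 0) :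
    HasSum (fun d => f (d + e)) a ↔ HasSum f a :=
  (add_left_injective e).hasSum_iff fun d hd =>
    hf d fun hle => hd ⟨d - e, tsub_add_cancel_of_le hle⟩

variable {σ R : Type*} [CommRing R]

theorem degree_le_order_prod_pow {τ : Type*} {a : σ → MvPowerSeries τ R}
    (ha : ∀ s, constantCoeff (a s) = 0) (m : σ →₀ ℕ) :
    (m.degree : ℕ∞) ≤ (m.prod fun s e => a s ^ e).order :=
  calc (m.degree : ℕ∞) = ∑ s ∈ m.support, (m s : ℕ∞) := by rw [Finsupp.degree_apply, Nat.cast_sum]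
    _ ≤ ∑ s ∈ m.support, (a s ^ m s).order :=
        sum_le_sum fun s _ => le_order_pow_of_constantCoeff_eq_zero _ (ha s)
    _ ≤ _ := le_order_prod _ _

/-- The power series all of whose exponents lie in an additive submonoid of multiindices. -/
def supportedSubring (R : Type*) [CommRing R] (P : AddSubmonoid (σ →₀ ℕ)) :
    Subring (MvPowerSeries σ R) where
  carrier := {f | ∀ d, coeff d f ≠ 0 → d ∈ P}
  mul_mem' := by
    classical
    intro f g hf hg d hd
    rw [coeff_mul] at hd
    obtain ⟨p, hp, hne⟩ := exists_ne_zero_of_sum_ne_zero hd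
    rw [← HasAntidiagonal.mem_antidiagonal.1 hp]
    exact P.add_mem (hf _ (left_ne_zero_of_mul hne)) (hg _ (right_ne_zero_of_mul hne))
  one_mem' := by
    classical
    intro d hd
    rw [coeff_one, ne_eq, ite_eq_right_iff, not_forall] at hd
    exact hd.1 ▸ P.zero_mem
  add_mem' := by
    intro f g hf hg d hd
    by_contra h
    exact hd (by rw [map_add, not_not.1 (mt (hf d) h), not_not.1 (mt (hg d) h), add_zero])
  zero_mem' := fun d hd => absurd (map_zero (coeff d)) hd
  neg_mem' := fun hf d hd => hf d (by simpa using hd)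

theorem monomial_mem_supportedSubring {P : AddSubmonoid (σ →₀ ℕ)} {d : σ →₀ ℕ} (hd : d ∈ P)
    (c : R) : monomial d c ∈ supportedSubring R P := by
  classical
  intro e he
  rw [coeff_monomial, ne_eq, ite_eq_right_iff, not_forall] at he
  exact he.1 ▸ hd

theorem subst_mem_supportedSubring {P : AddSubmonoid (σ →₀ ℕ)} {a : MvPowerSeries σ R}
    (ha : PowerSeries.HasSubst a) (haP : a ∈ supportedSubring R P) (p : PowerSeries R) :
    p.subst a ∈ supportedSubring R P := by
  intro d hd
  rw [PowerSeries.coeff_subst ha] at hd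
  obtain ⟨k, hk⟩ := not_forall.1 (mt finsum_eq_zero_of_forall_eq_zero hd)
  exact pow_mem haP k d (right_ne_zero_of_smul hk)

section Topology

variable [UniformSpace R] [DiscreteUniformity R]

theorem summableFamily_iff_summable {ι : Type*} (f : ι → MvPowerSeries σ R) :
    SummableFamily f ↔ Summable f := by
  rw [WithPiTopology.summable_iff_summable_coeff]
  exact forall_congr' fun d =>
    ⟨fun h => summable_of_hasFiniteSupport h, fun h => h.hasFiniteSupport_of_discreteTopology⟩

theorem summableFamily_of_hasSum {ι : Type*} {f : ι → MvPowerSeries σ R} {a : MvPowerSeries σ R}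
    (h : HasSum f a) : SummableFamily f :=
  (summableFamily_iff_summable f).2 h.summable

theorem familySum_eq_of_hasSum {ι : Type*} {f : ι → MvPowerSeries σ R} {a : MvPowerSeries σ R}
    (h : HasSum f a) : familySum f = a := by
  ext d
  rw [← (WithPiTopology.hasSum_iff_hasSum_coeff.1 h d).tsum_eq,
    tsum_eq_finsum (summableFamily_of_hasSum h d)]
  rfl

theorem hasSum_familySum {ι : Type*} {f : ι → MvPowerSeries σ R} (h : SummableFamily f) :
    HasSum f (familySum f) := by
  have hf := ((summableFamily_iff_summable f).1 h).hasSum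
  rwa [familySum_eq_of_hasSum hf]

theorem hasSum_subst {τ : Type*} {a : σ → MvPowerSeries τ R} (ha : HasSubst a)
    (f : MvPowerSeries σ R) :
    HasSum (fun m : σ →₀ ℕ => C (coeff m f) * m.prod fun s e => a s ^ e) (f.subst a) := by
  rw [subst_eq_eval₂]
  exact hasSum_eval₂ (continuous_algebraMap R _) ha.hasEval f

theorem hasSum_powerSeries_subst {a : MvPowerSeries σ R} (ha : PowerSeries.HasSubst a)
    (p : PowerSeries R) : HasSum (fun k : ℕ => C (PowerSeries.coeff k p) * a ^ k) (p.subst a) := by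
  have h := hasSum_subst ha.const p
  rw [← (Finsupp.uniqueEquiv ()).symm.hasSum_iff] at h
  refine h.congr_fun fun k => ?_
  simp [PowerSeries.coeff]

theorem hasSum_pderiv {ι : Type*} {f : ι → MvPowerSeries σ R} {a : MvPowerSeries σ R}
    (h : HasSum f a) (s : σ) : HasSum (fun k => pderiv R s (f k)) (pderiv R s a) := by
  rw [WithPiTopology.hasSum_iff_hasSum_coeff] at h ⊢
  intro d
  simp only [coeff_pderiv]
  exact (h _).mul_right _

end Topology

theorem pderiv_powerSeries_subst {a : MvPowerSeries σ R} (ha : PowerSeries.HasSubst a)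
    (p : PowerSeries R) (s : σ) :
    pderiv R s (p.subst a) = (PowerSeries.derivative R p).subst a * pderiv R s a := by
  let _ : UniformSpace R := ⊥
  have _ : DiscreteUniformity R := ⟨rfl⟩
  have hderiv := hasSum_pderiv (hasSum_powerSeries_subst ha p) s
  rw [← hasSum_nat_add_iff' 1] at hderiv
  rw [sum_range_one, pow_zero, mul_one, pderiv_C, sub_zero] at hderiv
  refine hderiv.unique (((hasSum_powerSeries_subst ha _).mul_right _).congr_fun fun k => ?_)
  rw [Derivation.leibniz, pderiv_C, pderiv_pow, PowerSeries.coeff_derivative]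
  simp only [Nat.cast_add, Nat.cast_one, add_tsub_cancel_right, smul_eq_mul, mul_zero, add_zero,
    map_mul, map_add, map_natCast, map_one]
  ring

end PowerSeries

/-! ### Wick's theorem -/

section Wick

variable {n : ℕ} {R : Type*} [CommRing R] (A : Matrix (Fin n) (Fin n) R)

theorem wickSum_option_right {K₁ K₂ : Type*} [Fintype K₁] [DecidableEq K₁] [Fintype K₂]
    [DecidableEq K₂] (τ₁ : K₁ → Fin n) (τ₂ : K₂ → Fin n) (i : Fin n) :
    wickSum A τ₁ (fun o : Option K₂ => o.elim i τ₂) =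
      ∑ k : K₁, A⁻¹ i (τ₁ k) * wickSum A (fun x : {x // x ≠ k} => τ₁ x) τ₂ := by
  have sum_symm : wickSum A τ₁ (fun o : Option K₂ => o.elim i τ₂) =
      ∑ e : Option K₂ ≃ K₁, ∏ o : Option K₂, A⁻¹ (o.elim i τ₂) (τ₁ (e o)) :=
    Fintype.sum_equiv ⟨Equiv.symm, Equiv.symm, fun _ => rfl, fun _ => rfl⟩ _ _ fun e =>
      Fintype.prod_equiv e _ _ fun k => by simp
  rw [sum_symm, ← Fintype.sum_fiberwise (g := fun e : Option K₂ ≃ K₁ => e none)]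
  refine sum_congr rfl fun k _ => ?_
  rw [wickSum, mul_sum]
  refine Fintype.sum_equiv ((Equiv.optionSubtype k).trans
    ⟨Equiv.symm, Equiv.symm, fun _ => rfl, fun _ => rfl⟩) _ _ fun e => ?_
  rw [Fintype.prod_option, Option.elim_none, e.2]
  congr 1
  exact Fintype.prod_equiv (Equiv.optionSubtype k e) _ _ fun o => by simp

theorem mult_subtype_ne {K : Type*} [Fintype K] [DecidableEq K] (τ : K → Fin n) (k : K) :
    mult (fun x : {x // x ≠ k} => τ x) = mult τ - Finsupp.single (τ k) 1 := by
  rw [mult, mult, Fintype.sum_eq_add_sum_subtype_ne _ k, add_tsub_cancel_left]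

theorem mult_sigma_fst (α : Fin n →₀ ℕ) :
    mult (Sigma.fst : (Σ j, Fin (α j)) → Fin n) = α := by
  ext j
  simp [mult, Fintype.sum_sigma]

theorem gaussMonomial_add_single (α β : Fin n →₀ ℕ) (i : Fin n) :
    gaussMonomial A α (β + Finsupp.single i 1 : Fin n →₀ ℕ) =
      ∑ l, A⁻¹ i l * (α l * gaussMonomial A (α - Finsupp.single l 1 : Fin n →₀ ℕ) β) := by
  have mult_option : mult (fun o : Option (Σ j, Fin (β j)) => o.elim i Sigma.fst) =
      β + Finsupp.single i 1 := by
    rw [mult, Fintype.sum_option, add_comm]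
    exact congrArg (· + _) (mult_sigma_fst β)
  have remove (l : Fin n) (k : Fin (α l)) :
      gaussMonomial A (α - Finsupp.single l 1 : Fin n →₀ ℕ) β = Ring.inverse A.det *
        wickSum A (fun x : {x : (Σ j, Fin (α j)) // x ≠ ⟨l, k⟩} => x.1.1)
          (Sigma.fst : (Σ j, Fin (β j)) → Fin n) := by
    refine gaussMonomial_eq A _ _ _ _ (DFunLike.congr_fun ?_)
      (DFunLike.congr_fun (mult_sigma_fst β))
    rw [mult_subtype_ne Sigma.fst, mult_sigma_fst]
  rw [gaussMonomial_eq A _ _ (Sigma.fst : (Σ j, Fin (α j)) → Fin n) _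
      (DFunLike.congr_fun (mult_sigma_fst α)) (DFunLike.congr_fun mult_option),
    wickSum_option_right, Fintype.sum_sigma, mul_sum]
  refine sum_congr rfl fun l _ => ?_
  calc Ring.inverse A.det * ∑ k : Fin (α l), A⁻¹ i l *
        wickSum A (fun x : {x : (Σ j, Fin (α j)) // x ≠ ⟨l, k⟩} => x.1.1) Sigma.fst
      = ∑ _k : Fin (α l), A⁻¹ i l * gaussMonomial A (α - Finsupp.single l 1 : Fin n →₀ ℕ) β := by
        rw [mul_sum]
        exact sum_congr rfl fun k _ => by rw [remove l k, mul_left_comm]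
    _ = A⁻¹ i l * (α l * gaussMonomial A (α - Finsupp.single l 1 : Fin n →₀ ℕ) β) := by
        rw [sum_const, card_univ, Fintype.card_fin, nsmul_eq_mul, mul_left_comm]

theorem gaussMonomial_eq_zero {α β : Fin n →₀ ℕ} (h : α.degree ≠ β.degree) :
    gaussMonomial A α β = 0 := by
  have : IsEmpty ((Σ j, Fin (α j)) ≃ (Σ j, Fin (β j))) :=
    ⟨fun e => h (by simpa [Finsupp.degree_eq_sum] using Fintype.card_congr e)⟩
  rw [gaussMonomial, wickSum, Fintype.sum_empty, mul_zero]

theorem gaussMonomial_zero_zero :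
    gaussMonomial A (0 : Fin n →₀ ℕ) (0 : Fin n →₀ ℕ) = Ring.inverse A.det := by
  have : IsEmpty (Σ j, Fin ((0 : Fin n →₀ ℕ) j)) := ⟨fun x => Fin.elim0 x.2⟩
  rw [gaussMonomial, wickSum, Fintype.sum_unique, Fintype.prod_empty, mul_one]

end Wick

/-! ### Formal Gaussian integration by parts -/

section Exponents

variable {n : ℕ}

/-- The exponents of the `ū`-variables in a multiindex of the `3n` variables. -/
def ubarPart : (FieldVar n →₀ ℕ) →+ (Fin n →₀ ℕ) :=
  Finsupp.comapDomain.addMonoidHom (f := ubarVar) Sum.inl_injective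

/-- The exponents of the `u`-variables in a multiindex of the `3n` variables. -/
def uPart : (FieldVar n →₀ ℕ) →+ (Fin n →₀ ℕ) :=
  Finsupp.comapDomain.addMonoidHom (f := uVar) (Sum.inr_injective.comp Sum.inl_injective)

/-- The exponents of the `Y`-variables in a multiindex of the `3n` variables. -/
def yPart : (FieldVar n →₀ ℕ) →+ (Fin n →₀ ℕ) :=
  Finsupp.comapDomain.addMonoidHom (f := yVar) (Sum.inr_injective.comp Sum.inr_injective)

/-- The multiindex of the `3n` variables which is `m` on the `u`-variables and `0` elsewhere. -/
def uExponent (m : Fin n →₀ ℕ) : FieldVar n →₀ ℕ :=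
  m.embDomain ⟨uVar, Sum.inr_injective.comp Sum.inl_injective⟩

@[simp] theorem ubarPart_apply (d : FieldVar n →₀ ℕ) (j : Fin n) :
    ubarPart d j = d (ubarVar j) := rfl

@[simp] theorem uPart_apply (d : FieldVar n →₀ ℕ) (j : Fin n) : uPart d j = d (uVar j) := rfl

@[simp] theorem yPart_apply (d : FieldVar n →₀ ℕ) (j : Fin n) : yPart d j = d (yVar j) := rfl

@[simp] theorem ubarPart_single_ubarVar (l : Fin n) (k : ℕ) :
    ubarPart (Finsupp.single (ubarVar l) k) = Finsupp.single l k := by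
  ext; simp [Finsupp.single_apply]

@[simp] theorem uPart_single_ubarVar (l : Fin n) (k : ℕ) :
    uPart (Finsupp.single (ubarVar l) k) = 0 := by
  ext; simp

@[simp] theorem yPart_single_ubarVar (l : Fin n) (k : ℕ) :
    yPart (Finsupp.single (ubarVar l) k) = 0 := by
  ext; simp

@[simp] theorem ubarPart_single_yVar (l : Fin n) (k : ℕ) :
    ubarPart (Finsupp.single (yVar l) k) = 0 := by
  ext; simp

@[simp] theorem uPart_single_yVar (l : Fin n) (k : ℕ) :
    uPart (Finsupp.single (yVar l) k) = 0 := by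
  ext; simp

@[simp] theorem yPart_single_yVar (l : Fin n) (k : ℕ) :
    yPart (Finsupp.single (yVar l) k) = Finsupp.single l k := by
  ext; simp [Finsupp.single_apply]

@[simp] theorem ubarPart_uExponent (m : Fin n →₀ ℕ) : ubarPart (uExponent m) = 0 := by
  ext
  exact Finsupp.embDomain_of_notMem_range _ _ _ (by simp)

@[simp] theorem uPart_uExponent (m : Fin n →₀ ℕ) : uPart (uExponent m) = m := by
  ext j
  exact Finsupp.embDomain_apply_self _ m j

@[simp] theorem yPart_uExponent (m : Fin n →₀ ℕ) : yPart (uExponent m) = 0 := by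
  ext
  exact Finsupp.embDomain_of_notMem_range _ _ _ (by simp)

theorem uExponent_single (i : Fin n) (k : ℕ) :
    uExponent (Finsupp.single i k) = Finsupp.single (uVar i) k :=
  Finsupp.embDomain_single _ _ _

theorem uExponent_add (m k : Fin n →₀ ℕ) : uExponent (m + k) = uExponent m + uExponent k :=
  Finsupp.embDomain_add _ _ _

theorem degree_eq_degree_parts (d : FieldVar n →₀ ℕ) :
    d.degree = (ubarPart d).degree + ((uPart d).degree + (yPart d).degree) := by
  simp [Finsupp.degree_eq_sum, Fintype.sum_sum_type]

end Exponents

section Gauss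

variable {n : ℕ} {R : Type*} [CommRing R] (A : Matrix (Fin n) (Fin n) R)

theorem gaussTerm_eq (U : MvPowerSeries (FieldVar n) R) (d : FieldVar n →₀ ℕ) :
    gaussTerm A U d =
      monomial (yPart d) (coeff d U * gaussMonomial A (ubarPart d) (uPart d)) := by
  have exponent : (Finsupp.equivFunOnFinite.symm fun j => d (yVar j)) = yPart d := by
    ext
    rfl
  rw [gaussTerm, exponent]
  rfl

variable {A} in
theorem parts_of_coeff_gaussTerm_ne_zero {U : MvPowerSeries (FieldVar n) R} {a : Fin n →₀ ℕ}
    {d : FieldVar n →₀ ℕ} (h : coeff a (gaussTerm A U d) ≠ 0) :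
    yPart d = a ∧ (ubarPart d).degree = (uPart d).degree ∧ coeff d U ≠ 0 := by
  classical
  rw [gaussTerm_eq, coeff_monomial, ne_eq, ite_eq_right_iff, not_forall] at h
  obtain ⟨ha, hne⟩ := h
  exact ⟨ha.symm, not_not.1 (mt (gaussMonomial_eq_zero A) (right_ne_zero_of_mul hne)),
    left_ne_zero_of_mul hne⟩

variable [UniformSpace R]

/-- `∫ dū du e^{-ūAu} U` is defined and equal to `a`, as an unconditional sum in the product
topology of `R[[Y]]`; this form is additive in `U` without side conditions. -/
def HasGaussIntegral (U : MvPowerSeries (FieldVar n) R) (a : MvPowerSeries (Fin n) R) : Prop :=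
  HasSum (gaussTerm A U) a

variable {A} in
theorem HasGaussIntegral.hasSum_of_pderiv {U : MvPowerSeries (FieldVar n) R}
    {a : MvPowerSeries (Fin n) R} {l : Fin n}
    (h : HasGaussIntegral A (pderiv R (ubarVar l) U) a) :
    HasSum (fun d => monomial (yPart d) (coeff d U * (d (ubarVar l) *
      gaussMonomial A (ubarPart d - Finsupp.single l 1 : Fin n →₀ ℕ) (uPart d)))) a := by
  refine (hasSum_comp_add_right_iff (e := Finsupp.single (ubarVar l) 1) fun d hd => ?_).1
    (h.congr_fun fun d => ?_)
  · have hl : d (ubarVar l) = 0 := by simpa [Nat.one_le_iff_ne_zero] using hd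
    simp [hl]
  · rw [gaussTerm_eq, coeff_pderiv]
    simp [mul_assoc]

variable [DiscreteUniformity R]

variable {A} in
theorem GaussIntegrable.hasGaussIntegral {U : MvPowerSeries (FieldVar n) R}
    (h : GaussIntegrable A U) : HasGaussIntegral A U (gaussIntegral A U) :=
  hasSum_familySum h

namespace HasGaussIntegral

variable {A} {U V : MvPowerSeries (FieldVar n) R} {a b : MvPowerSeries (Fin n) R}

theorem gaussIntegral_eq (h : HasGaussIntegral A U a) : gaussIntegral A U = a :=
  familySum_eq_of_hasSum h

theorem add (hU : HasGaussIntegral A U a) (hV : HasGaussIntegral A V b) :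
    HasGaussIntegral A (U + V) (a + b) :=
  (HasSum.add hU hV).congr_fun fun d => by simp only [gaussTerm_eq, map_add, add_mul]

theorem C_mul (hU : HasGaussIntegral A U a) (c : R) :
    HasGaussIntegral A (C c * U) (C c * a) :=
  (HasSum.mul_left (C c) hU).congr_fun fun d => by
    rw [gaussTerm_eq, gaussTerm_eq, coeff_C_mul, ← monomial_zero_eq_C_apply,
      monomial_mul_monomial, zero_add, mul_assoc]

theorem X_yVar_mul (hU : HasGaussIntegral A U a) (l : Fin n) :
    HasGaussIntegral A (X (yVar l) * U) (X l * a) := by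
  classical
  refine (hasSum_comp_add_right_iff (e := Finsupp.single (yVar l) 1) fun d hd => ?_).1
    ((HasSum.mul_left (X l) hU).congr_fun fun d => ?_)
  · rw [gaussTerm_eq, X, coeff_monomial_mul, if_neg hd, zero_mul, map_zero]
  · rw [gaussTerm_eq, gaussTerm_eq, add_comm d, X, X, coeff_add_monomial_mul,
      monomial_mul_monomial]
    simp

/-- Integration by parts: the total `ū_l`-derivative `∂(e^{-ūAu} U)/∂ū_l` integrates to zero. -/
theorem X_uVar_mul {b : Fin n → MvPowerSeries (Fin n) R}
    (h : ∀ l, HasGaussIntegral A (pderiv R (ubarVar l) U) (b l)) (i : Fin n) :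
    HasGaussIntegral A (X (uVar i) * U) (∑ l, C (A⁻¹ i l) * b l) := by
  classical
  refine (hasSum_comp_add_right_iff (e := Finsupp.single (uVar i) 1) fun d hd => ?_).1
    ((hasSum_sum fun l _ => (h l).hasSum_of_pderiv.mul_left (C (A⁻¹ i l))).congr_fun fun d => ?_)
  · rw [gaussTerm_eq, X, coeff_monomial_mul, if_neg hd, zero_mul, map_zero]
  · rw [gaussTerm_eq, add_comm d, X, coeff_add_monomial_mul, ← uExponent_single, one_mul]
    simp only [map_add, ubarPart_uExponent, uPart_uExponent, yPart_uExponent, zero_add]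
    rw [add_comm _ (uPart d), gaussMonomial_add_single, mul_sum, map_sum]
    refine sum_congr rfl fun l _ => ?_
    rw [← monomial_zero_eq_C_apply, monomial_mul_monomial, zero_add, ubarPart_apply,
      mul_left_comm]

theorem of_hasSum {ι : Type*} {W : ι → MvPowerSeries (FieldVar n) R}
    (hV : HasSum W V) (hW : Summable fun p : ι × (FieldVar n →₀ ℕ) => gaussTerm A (W p.1) p.2) :
    HasGaussIntegral A V (∑' k, gaussIntegral A (W k)) := by
  have integrals : HasSum (fun k => gaussIntegral A (W k))
      (∑' p : ι × (FieldVar n →₀ ℕ), gaussTerm A (W p.1) p.2) :=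
    hW.hasSum.prod_fiberwise fun k => hasSum_familySum
      ((summableFamily_iff_summable _).2 (hW.comp_injective (Prod.mk_right_injective k)))
  rw [integrals.tsum_eq]
  rw [← (Equiv.prodComm _ _).summable_iff] at hW
  rw [← (Equiv.prodComm _ _).tsum_eq]
  refine hW.hasSum.prod_fiberwise fun d => ?_
  rw [WithPiTopology.hasSum_iff_hasSum_coeff]
  intro a
  classical
  simp only [Function.comp_apply, Equiv.prodComm_apply, Prod.swap_prod_mk, gaussTerm_eq,
    coeff_monomial]
  split_ifs
  · exact (WithPiTopology.hasSum_iff_hasSum_coeff.1 hV d).mul_right _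
  · exact hasSum_zero

end HasGaussIntegral

end Gauss

/-! ### The interaction -/

section Rename

variable {n : ℕ} {R : Type*} [CommRing R] (f : MvPowerSeries (Fin n) R)

theorem coeff_uExponent_rename (m : Fin n →₀ ℕ) :
    coeff (uExponent m) (rename uVar f) = coeff m f :=
  coeff_embDomain_rename ⟨uVar, _⟩ _ _

theorem coeff_rename_uVar_eq_zero {d : FieldVar n →₀ ℕ} (hd : d ∉ Set.range uExponent) :
    coeff d (rename uVar f) = 0 := by
  refine coeff_rename_eq_zero uVar f ?_
  rintro ⟨m, hm⟩
  exact hd ⟨m, by rw [← hm, uExponent, Finsupp.embDomain_eq_mapDomain]; rfl⟩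

theorem pderiv_ubarVar_rename_uVar (l : Fin n) : pderiv R (ubarVar l) (rename uVar f) = 0 := by
  ext d
  rw [coeff_pderiv, map_zero, coeff_rename_uVar_eq_zero, zero_mul]
  rintro ⟨m, hm⟩
  simpa using DFunLike.congr_fun (congrArg ubarPart hm) l

theorem hasSum_rename_uVar [UniformSpace R] :
    HasSum (fun m => monomial (uExponent m) (coeff m f)) (rename uVar f) := by
  have h := WithPiTopology.hasSum_of_monomials_self (rename uVar f)
  rw [← (Finsupp.embDomain_injective ⟨uVar, _⟩).hasSum_iff fun d hd => by
    rw [coeff_rename_uVar_eq_zero f hd, map_zero]] at h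
  exact h.congr_fun fun m => by rw [← coeff_uExponent_rename f m]; rfl

end Rename

section Interaction

variable {n : ℕ}

/-- The exponents of `ū`, `u` and `Y` that can occur in `exp(ūH(u) + ūY)`: every `ū` comes with
two `u` or with one `Y`. -/
def interactionExponents (n : ℕ) : AddSubmonoid (FieldVar n →₀ ℕ) where
  carrier := {d | 2 * (ubarPart d).degree ≤ (uPart d).degree + 2 * (yPart d).degree}
  add_mem' := by
    intro d e hd he
    simp only [Set.mem_ofPred_eq, map_add] at *
    omega
  zero_mem' := by simp

theorem mem_interactionExponents {d : FieldVar n →₀ ℕ} : d ∈ interactionExponents n ↔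
    2 * (ubarPart d).degree ≤ (uPart d).degree + 2 * (yPart d).degree := Iff.rfl

variable {R : Type*} [CommRing R] (F : Fin n → MvPowerSeries (Fin n) R)

theorem coeff_nonlin (l : Fin n) (k : Fin n →₀ ℕ) :
    coeff k (nonlin F l) = if 2 ≤ k.degree then -coeff k (F l) else 0 := rfl

theorem two_le_degree_of_coeff_nonlin_ne_zero {l : Fin n} {k : Fin n →₀ ℕ}
    (h : coeff k (nonlin F l) ≠ 0) : 2 ≤ k.degree := by
  by_contra hk
  exact h (by rw [coeff_nonlin, if_neg hk])

theorem X_mul_rename_nonlin_mem (l : Fin n) : X (ubarVar l) * rename uVar (nonlin F l) ∈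
    supportedSubring R (interactionExponents n) := by
  classical
  intro d hd
  rw [X, coeff_monomial_mul, one_mul, ne_eq, ite_eq_right_iff, not_forall] at hd
  obtain ⟨hle, hne⟩ := hd
  obtain ⟨k, hk⟩ := not_not.1 (mt (coeff_rename_uVar_eq_zero (nonlin F l)) hne)
  rw [← hk, coeff_uExponent_rename] at hne
  have hk2 := two_le_degree_of_coeff_nonlin_ne_zero F hne
  rw [← tsub_add_cancel_of_le hle, ← hk, mem_interactionExponents]
  simpa using hk2

theorem interaction_mem : interaction F ∈ supportedSubring R (interactionExponents n) := by
  refine add_mem (sum_mem fun l _ => X_mul_rename_nonlin_mem F l) (sum_mem fun l _ => ?_)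
  rw [X, X, monomial_mul_monomial]
  exact monomial_mem_supportedSubring (by simp [mem_interactionExponents]) _

theorem hasSubst_interaction : PowerSeries.HasSubst (interaction F) :=
  .of_constantCoeff_zero (by simp [interaction])

theorem pderiv_interaction (l : Fin n) : pderiv R (ubarVar l) (interaction F) =
    rename uVar (nonlin F l) + X (yVar l) := by
  classical
  simp [interaction, pderiv_ubarVar_rename_uVar, pderiv_X, Pi.single_apply]

variable [Algebra ℚ R]

theorem expInteraction_mem :
    expInteraction F ∈ supportedSubring R (interactionExponents n) :=
  subst_mem_supportedSubring (hasSubst_interaction F) (interaction_mem F) _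

theorem constantCoeff_expInteraction : constantCoeff (expInteraction F) = 1 := by
  rw [expInteraction, PowerSeries.constantCoeff_subst (hasSubst_interaction F),
    finsum_eq_single _ 0]
  · simp
  · intro k hk
    simp [interaction, hk]

theorem pderiv_expInteraction (l : Fin n) : pderiv R (ubarVar l) (expInteraction F) =
    (rename uVar (nonlin F l) + X (yVar l)) * expInteraction F := by
  rw [expInteraction, pderiv_powerSeries_subst (hasSubst_interaction F), pderiv_interaction,
    PowerSeries.derivative_exp, mul_comm]

end Interaction

/-! ### Moments and the Schwinger–Dyson equations -/

section Moments

variable {n : ℕ} {R : Type*} [CommRing R]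

theorem degree_le_of_coeff_gaussTerm_ne_zero {A : Matrix (Fin n) (Fin n) R}
    {U : MvPowerSeries (FieldVar n) R} (hU : U ∈ supportedSubring R (interactionExponents n))
    {m a : Fin n →₀ ℕ} {c : R} {d : FieldVar n →₀ ℕ}
    (h : coeff a (gaussTerm A (monomial (uExponent m) c * U) d) ≠ 0) :
    d.degree ≤ 5 * a.degree ∧ m.degree ≤ a.degree := by
  classical
  obtain ⟨rfl, hbal, hne⟩ := parts_of_coeff_gaussTerm_ne_zero h
  rw [coeff_monomial_mul, ne_eq, ite_eq_right_iff, not_forall] at hne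
  obtain ⟨hle, hne⟩ := hne
  obtain ⟨e, rfl⟩ := le_iff_exists_add.1 hle
  have he := hU _ (right_ne_zero_of_mul hne)
  rw [add_tsub_cancel_left, mem_interactionExponents] at he
  rw [degree_eq_degree_parts, hbal]
  simp only [map_add, ubarPart_uExponent, uPart_uExponent, yPart_uExponent, zero_add]
    at hbal ⊢
  omega

theorem gaussIntegrable_monomial_mul {A : Matrix (Fin n) (Fin n) R}
    {U : MvPowerSeries (FieldVar n) R} (hU : U ∈ supportedSubring R (interactionExponents n))
    (m : Fin n →₀ ℕ) (c : R) : GaussIntegrable A (monomial (uExponent m) c * U) := fun a =>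
  (Finsupp.finite_of_degree_le (5 * a.degree)).subset fun _ hd =>
    (degree_le_of_coeff_gaussTerm_ne_zero hU hd).1

theorem monomial_uExponent_zero : monomial (uExponent (0 : Fin n →₀ ℕ)) (1 : R) = 1 := by
  rw [uExponent, Finsupp.embDomain_zero, monomial_zero_one]

theorem monomial_uExponent_single (i : Fin n) :
    monomial (uExponent (Finsupp.single i 1)) (1 : R) = X (uVar i) := by
  rw [uExponent_single, X]

theorem summable_gaussTerm_monomial_mul [UniformSpace R] [DiscreteUniformity R]
    {A : Matrix (Fin n) (Fin n) R} {U : MvPowerSeries (FieldVar n) R}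
    (hU : U ∈ supportedSubring R (interactionExponents n)) (m : Fin n →₀ ℕ)
    (c : (Fin n →₀ ℕ) → R) :
    Summable fun p : (Fin n →₀ ℕ) × (FieldVar n →₀ ℕ) =>
      gaussTerm A (monomial (uExponent (m + p.1)) (c p.1) * U) p.2 := by
  refine (summableFamily_iff_summable _).1 fun a => ?_
  refine ((Finsupp.finite_of_degree_le a.degree).prod
    (Finsupp.finite_of_degree_le (5 * a.degree))).subset fun p hp => ?_
  obtain ⟨hd, hm⟩ := degree_le_of_coeff_gaussTerm_ne_zero hU hp
  rw [map_add] at hm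
  exact ⟨le_of_add_le_right hm, hd⟩

variable [Algebra ℚ R] (F : Fin n → MvPowerSeries (Fin n) R)

/-- The formal Gaussian integral of `u^m exp(ūH(u) + ūY)`. -/
def moment (m : Fin n →₀ ℕ) : MvPowerSeries (Fin n) R :=
  gaussIntegral (linMatrix F) (monomial (uExponent m) 1 * expInteraction F)

theorem moment_zero : moment F 0 = gaussIntegral (linMatrix F) (expInteraction F) := by
  rw [moment, monomial_uExponent_zero, one_mul]

theorem moment_single (i : Fin n) : moment F (Finsupp.single i 1) =
    gaussIntegral (linMatrix F) (X (uVar i) * expInteraction F) := by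
  rw [moment, monomial_uExponent_single]

theorem coeff_moment_eq_zero {m a : Fin n →₀ ℕ} (h : a.degree < m.degree) :
    coeff a (moment F m) = 0 :=
  finsum_eq_zero_of_forall_eq_zero fun _ => by
    by_contra hd
    exact h.not_ge (degree_le_of_coeff_gaussTerm_ne_zero (expInteraction_mem F) hd).2

theorem constantCoeff_moment_zero :
    constantCoeff (moment F 0) = Ring.inverse (linMatrix F).det := by
  rw [← coeff_zero_eq_constantCoeff_apply]
  refine (finsum_eq_single _ 0 fun d hd => ?_).trans ?_
  · by_contra hne
    have hdeg := (degree_le_of_coeff_gaussTerm_ne_zero (expInteraction_mem F) hne).1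
    exact hd ((Finsupp.degree_eq_zero_iff d).1 (by simpa using hdeg))
  · rw [gaussTerm_eq, map_zero, map_zero, map_zero, coeff_monomial_same, uExponent,
      Finsupp.embDomain_zero, monomial_zero_one, one_mul, coeff_zero_eq_constantCoeff_apply,
      constantCoeff_expInteraction, gaussMonomial_zero_zero, one_mul]

theorem isUnit_moment_zero (hA : IsUnit (linMatrix F)) : IsUnit (moment F 0) := by
  rw [isUnit_iff_constantCoeff, constantCoeff_moment_zero]
  exact ((Matrix.isUnit_iff_isUnit_det _).1 hA).ringInverse

variable [UniformSpace R] [DiscreteUniformity R]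

theorem hasGaussIntegral_moment (m : Fin n →₀ ℕ) :
    HasGaussIntegral (linMatrix F) (monomial (uExponent m) 1 * expInteraction F) (moment F m) :=
  (gaussIntegrable_monomial_mul (expInteraction_mem F) m 1).hasGaussIntegral

theorem hasGaussIntegral_rename_mul (h : MvPowerSeries (Fin n) R) (m : Fin n →₀ ℕ) :
    HasGaussIntegral (linMatrix F)
      (rename uVar h * (monomial (uExponent m) 1 * expInteraction F))
      (∑' k, C (coeff k h) * moment F (m + k)) := by
  have expansion : HasSum (fun k => monomial (uExponent (m + k)) (coeff k h) * expInteraction F)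
      (rename uVar h * (monomial (uExponent m) 1 * expInteraction F)) :=
    ((hasSum_rename_uVar h).mul_right _).congr_fun fun k => by
      rw [← mul_assoc, monomial_mul_monomial, mul_one, uExponent_add, add_comm]
  convert HasGaussIntegral.of_hasSum expansion
    (summable_gaussTerm_monomial_mul (expInteraction_mem F) m fun k => coeff k h) using 3 with k
  rw [← ((hasGaussIntegral_moment F (m + k)).C_mul (coeff k h)).gaussIntegral_eq, ← mul_assoc,
    ← monomial_zero_eq_C_apply, monomial_mul_monomial, zero_add, mul_one]

theorem moment_add_single (m : Fin n →₀ ℕ) (i : Fin n) :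
    moment F (m + Finsupp.single i 1) = ∑ l, C ((linMatrix F)⁻¹ i l) *
      (X l * moment F m + ∑' k, C (coeff k (nonlin F l)) * moment F (m + k)) := by
  have derivative (l : Fin n) : HasGaussIntegral (linMatrix F)
      (pderiv R (ubarVar l) (monomial (uExponent m) 1 * expInteraction F))
      (X l * moment F m + ∑' k, C (coeff k (nonlin F l)) * moment F (m + k)) := by
    have constant : pderiv R (ubarVar l) (monomial (uExponent m) (1 : R)) = 0 := by
      rw [uExponent, Finsupp.embDomain_eq_mapDomain]
      exact rename_monomial (R := R) uVar m 1 ▸ pderiv_ubarVar_rename_uVar _ l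
    rw [Derivation.leibniz, constant, smul_zero, add_zero, pderiv_expInteraction, smul_eq_mul,
      mul_left_comm, add_mul, add_comm]
    exact ((hasGaussIntegral_moment F m).X_yVar_mul l).add
      (hasGaussIntegral_rename_mul F (nonlin F l) m)
  rw [← (HasGaussIntegral.X_uVar_mul derivative i).gaussIntegral_eq, moment, X, ← mul_assoc,
    monomial_mul_monomial, mul_one, uExponent_add, uExponent_single, add_comm]

end Moments

section SchwingerDyson

variable {n : ℕ} {R : Type*} [CommRing R] [UniformSpace R]
  (F : Fin n → MvPowerSeries (Fin n) R)

/-- The Schwinger–Dyson equations for a family of power series indexed by the exponents of `u`,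
together with the vanishing to the order of the index which makes their solution unique. -/
structure SchwingerDyson (Ψ : (Fin n →₀ ℕ) → MvPowerSeries (Fin n) R) : Prop where
  coeff_eq_zero : ∀ m a : Fin n →₀ ℕ, a.degree < m.degree → coeff a (Ψ m) = 0
  add_single : ∀ m i, Ψ (m + Finsupp.single i 1) = ∑ l, C ((linMatrix F)⁻¹ i l) *
    (X l * Ψ m + ∑' k, C (coeff k (nonlin F l)) * Ψ (m + k))

variable [DiscreteUniformity R]

theorem schwingerDyson_moment [Algebra ℚ R] : SchwingerDyson F (moment F) :=
  ⟨fun _ _ h => coeff_moment_eq_zero F h, moment_add_single F⟩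

variable {F} {Ψ Ψ' : (Fin n →₀ ℕ) → MvPowerSeries (Fin n) R}

namespace SchwingerDyson

theorem coeff_tsum (h : SchwingerDyson F Ψ) (m a : Fin n →₀ ℕ) (c : (Fin n →₀ ℕ) → R) :
    coeff a (∑' k, C (c k) * Ψ (m + k)) = ∑' k, c k * coeff a (Ψ (m + k)) := by
  have summable : SummableFamily fun k => C (c k) * Ψ (m + k) := by
    intro a
    refine (Finsupp.finite_of_degree_le a.degree).subset fun k hk => ?_
    rw [Set.mem_ofPred_eq, coeff_C_mul] at hk
    have hdeg := not_lt.1 (mt (h.coeff_eq_zero (m + k) a) (right_ne_zero_of_mul hk))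
    rw [map_add] at hdeg
    exact le_of_add_le_right hdeg
  rw [← (WithPiTopology.hasSum_iff_hasSum_coeff.1
    ((summableFamily_iff_summable _).1 summable).hasSum a).tsum_eq]
  simp only [coeff_C_mul]

/-- The equation for `Ψ (m + e_i)` only involves coefficients of lower degree (through `X_l Ψ m`)
or values of `Ψ` at larger indices (since `H` starts in degree `2`). -/
theorem coeff_add_single_eq (h : SchwingerDyson F Ψ) (h' : SchwingerDyson F Ψ')
    (m a : Fin n →₀ ℕ) (i : Fin n)
    (lower : ∀ b : Fin n →₀ ℕ, b.degree < a.degree → coeff b (Ψ m) = coeff b (Ψ' m))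
    (higher : ∀ k : Fin n →₀ ℕ, 2 ≤ k.degree → coeff a (Ψ (m + k)) = coeff a (Ψ' (m + k))) :
    coeff a (Ψ (m + Finsupp.single i 1)) = coeff a (Ψ' (m + Finsupp.single i 1)) := by
  classical
  rw [h.add_single, h'.add_single, map_sum, map_sum]
  refine sum_congr rfl fun l _ => ?_
  rw [coeff_C_mul, coeff_C_mul, map_add, map_add, h.coeff_tsum, h'.coeff_tsum]
  congr 2
  · rw [X, coeff_monomial_mul, coeff_monomial_mul]
    split_ifs with hl
    · rw [lower]
      have hdeg := congrArg Finsupp.degree (tsub_add_cancel_of_le hl)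
      rw [map_add, Finsupp.degree_single] at hdeg
      omega
    · rfl
  · refine tsum_congr fun k => ?_
    by_cases hk : coeff k (nonlin F l) = 0
    · rw [hk, zero_mul, zero_mul]
    · rw [higher k (two_le_degree_of_coeff_nonlin_ne_zero F hk)]

theorem eq_of_zero_eq (h : SchwingerDyson F Ψ) (h' : SchwingerDyson F Ψ') (h0 : Ψ 0 = Ψ' 0)
    (m : Fin n →₀ ℕ) : Ψ m = Ψ' m := by
  ext a
  induction ha : a.degree using Nat.strong_induction_on generalizing a m with
  | _ N lower =>
  suffices H : ∀ j (m : Fin n →₀ ℕ), N < m.degree + j → coeff a (Ψ m) = coeff a (Ψ' m) from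
    H (N + 1) m (by omega)
  intro j
  induction j with
  | zero =>
    intro m hm
    rw [h.coeff_eq_zero m a (by omega), h'.coeff_eq_zero m a (by omega)]
  | succ j higher =>
    intro m hm
    obtain rfl | hm0 := eq_or_ne m 0
    · rw [h0]
    obtain ⟨i, hi⟩ := DFunLike.ne_iff.1 hm0
    obtain ⟨m, rfl⟩ : ∃ m', m = m' + Finsupp.single i 1 :=
      ⟨m - Finsupp.single i 1, (tsub_add_cancel_of_le (by
        simpa [Nat.one_le_iff_ne_zero] using hi)).symm⟩
    rw [map_add, Finsupp.degree_single] at hm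
    refine h.coeff_add_single_eq h' m a i (fun b hb => lower _ (ha ▸ hb) m b rfl)
      fun k hk => higher _ ?_
    rw [map_add]
    omega

end SchwingerDyson

theorem schwingerDyson_prod_pow {G : Fin n → MvPowerSeries (Fin n) R}
    (hG : ∀ i, constantCoeff (G i) = 0)
    (hrec : ∀ i, G i = ∑ l, C ((linMatrix F)⁻¹ i l) * (X l + (nonlin F l).subst G))
    (Z : MvPowerSeries (Fin n) R) :
    SchwingerDyson F fun m => (m.prod fun j e => G j ^ e) * Z := by
  have prod_add (m k : Fin n →₀ ℕ) : ((m + k).prod fun j e => G j ^ e) =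
      (m.prod fun j e => G j ^ e) * k.prod fun j e => G j ^ e :=
    Finsupp.prod_add_index' (fun _ => pow_zero _) fun _ => pow_add _
  have prod_single (i : Fin n) : ((Finsupp.single i 1).prod fun j e => G j ^ e) = G i := by
    rw [Finsupp.prod_single_index (h := fun j e => G j ^ e) (pow_zero _), pow_one]
  refine ⟨fun m a ha => coeff_of_lt_order ?_, fun m i => ?_⟩
  · calc (a.degree : ℕ∞) < m.degree := by exact_mod_cast ha
      _ ≤ (m.prod fun j e => G j ^ e).order := degree_le_order_prod_pow hG m
      _ ≤ _ := le_self_add.trans le_order_mul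
  · have tsum_eq (l : Fin n) : ∑' k, C (coeff k (nonlin F l)) *
        (((m + k).prod fun j e => G j ^ e) * Z) =
        (nonlin F l).subst G * ((m.prod fun j e => G j ^ e) * Z) := by
      refine HasSum.tsum_eq (((hasSum_subst (hasSubst_of_constantCoeff_zero hG)
        (nonlin F l)).mul_right _).congr_fun fun k => ?_)
      rw [prod_add]
      ring
    calc ((m + Finsupp.single i 1).prod fun j e => G j ^ e) * Z
        = G i * ((m.prod fun j e => G j ^ e) * Z) := by
          rw [prod_add, prod_single, mul_comm _ (G i), mul_assoc]
      _ = ∑ l, C ((linMatrix F)⁻¹ i l) * (X l * ((m.prod fun j e => G j ^ e) * Z) +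
            (nonlin F l).subst G * ((m.prod fun j e => G j ^ e) * Z)) := by
          rw [hrec i, sum_mul]
          exact sum_congr rfl fun l _ => by ring
      _ = _ := sum_congr rfl fun l _ => by rw [tsum_eq]

theorem moment_single_eq [Algebra ℚ R] {G : Fin n → MvPowerSeries (Fin n) R}
    (hG : ∀ i, constantCoeff (G i) = 0)
    (hrec : ∀ i, G i = ∑ l, C ((linMatrix F)⁻¹ i l) * (X l + (nonlin F l).subst G))
    (i : Fin n) : moment F (Finsupp.single i 1) = G i * moment F 0 := by
  rw [(schwingerDyson_moment F).eq_of_zero_eq (schwingerDyson_prod_pow hG hrec (moment F 0))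
    (by simp), Finsupp.prod_single_index (h := fun j e => G j ^ e) (pow_zero _), pow_one]

end SchwingerDyson

/-! ### Planar trees -/

theorem hasSum_sum_finsuppAntidiag {ι M : Type*} [Fintype ι] [DecidableEq ι] [AddCommMonoid M]
    [TopologicalSpace M] [ContinuousAdd M] [RegularSpace M] {f : (ι →₀ ℕ) → M} {a : M}
    (h : HasSum f a) : HasSum (fun d => ∑ q ∈ finsuppAntidiag univ d, f q) a := by
  have mem_iff (d : ℕ) (q : ι →₀ ℕ) : q.degree = d ↔ q ∈ finsuppAntidiag univ d := by
    simp [mem_finsuppAntidiag, Finsupp.degree_eq_sum]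
  rw [← (Equiv.sigmaFiberEquiv fun q : ι →₀ ℕ => q.degree).hasSum_iff] at h
  exact h.sigma fun d => (Equiv.subtypeEquivRight (mem_iff d)).hasSum_iff.2 (Finset.hasSum _ f)

section SumMult

variable {n d : ℕ}

theorem degree_mult (ks : Fin d → Fin n) : (mult ks).degree = d := by
  simp [mult, map_sum]

theorem prod_comp_eq_mult_prod {M : Type*} [CommMonoid M] (G : Fin n → M) (ks : Fin d → Fin n) :
    ∏ k, G (ks k) = (mult ks).prod fun j e => G j ^ e := by
  classical
  rw [Finsupp.prod_fintype _ _ fun _ => pow_zero _, ← prod_fiberwise univ ks]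
  refine prod_congr rfl fun j _ => ?_
  rw [prod_congr rfl fun k hk => by rw [(mem_filter.1 hk).2], prod_const, mult_apply,
    Fintype.card_subtype]

/-- Both sides are the images of the two expansions of `(∑ X_j) ^ d` under the additive map
sending the monomial `X ^ q` to `φ q`. -/
theorem sum_comp_mult {M : Type*} [AddCommMonoid M] (φ : (Fin n →₀ ℕ) → M) :
    ∑ ks : Fin d → Fin n, φ (mult ks) =
      ∑ q ∈ finsuppAntidiag univ d, Nat.multinomial univ q • φ q := by
  let Φ := (MvPolynomial.basisMonomials (Fin n) ℕ).constr ℕ φ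
  have Φ_monomial (q : Fin n →₀ ℕ) : Φ (MvPolynomial.monomial q 1) = φ q := by
    simpa only [MvPolynomial.coe_basisMonomials] using
      (MvPolynomial.basisMonomials (Fin n) ℕ).constr_basis ℕ φ q
  have expansion := congrArg Φ ((Fintype.sum_pow
    (fun j : Fin n => (MvPolynomial.X j : MvPolynomial (Fin n) ℕ)) d).symm.trans
    (sum_pow_eq_sum_piAntidiag univ _ d))
  rw [map_sum, map_sum] at expansion
  refine ((sum_congr rfl fun ks _ => ?_).trans expansion).trans
    (sum_equiv Finsupp.equivFunOnFinite.symm (fun q => ?_) fun q _ => ?_)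
  · rw [← Φ_monomial, mult, MvPolynomial.monomial_sum_one]
    rfl
  · simp [mem_piAntidiag, mem_finsuppAntidiag]
  · rw [← nsmul_eq_mul, map_nsmul, ← Φ_monomial, MvPolynomial.monomial_eq, map_one, one_mul,
      Finsupp.prod_fintype _ _ fun _ => pow_zero _]
    rfl

theorem inv_factorial_smul_sum_comp_mult {M : Type*} [AddCommGroup M] [Module ℚ M]
    (φ : (Fin n →₀ ℕ) → M) : (d.factorial : ℚ)⁻¹ • ∑ ks : Fin d → Fin n, φ (mult ks) =
      ∑ q ∈ finsuppAntidiag univ d, (∏ j, (q j).factorial : ℚ)⁻¹ • φ q := by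
  rw [sum_comp_mult, smul_sum]
  refine sum_congr rfl fun q hq => ?_
  rw [← Nat.cast_smul_eq_nsmul ℚ, smul_smul]
  congr 1
  have spec := congrArg (Nat.cast : ℕ → ℚ) (Nat.multinomial_spec univ q)
  rw [(mem_finsuppAntidiag.1 hq).1] at spec
  push_cast at spec
  have : (Nat.multinomial univ q : ℚ) ≠ 0 := by exact_mod_cast (Nat.multinomial_pos _ _).ne'
  rw [← spec, mul_inv, inv_mul_cancel_right₀ this]

end SumMult

/-- Planar rooted trees none of whose vertices has exactly one child. -/
inductive PTree : Type
  | mk (d : {d : ℕ // d ≠ 1}) (branch : Fin d → PTree) : PTree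

namespace PTree

/-- A planar tree is the same as the family of the branches at its root. -/
def equivSigma : (Σ d : {d : ℕ // d ≠ 1}, Fin d → PTree) ≃ PTree where
  toFun p := mk p.1 p.2
  invFun | mk d branch => ⟨d, branch⟩
  left_inv _ := rfl
  right_inv | mk _ _ => rfl

/-- The product over the vertices of the inverse of the number of orderings of their children. -/
def weight : PTree → ℚ
  | mk d branch => (d.1.factorial : ℚ)⁻¹ * ∏ k, (branch k).weight

/-- The number of leaves. -/
def leaves : PTree → ℕ
  | mk d branch => if d.1 = 0 then 1 else ∑ k, (branch k).leaves

theorem leaves_pos : ∀ t : PTree, 0 < t.leaves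
  | mk d branch => by
    rw [leaves]
    split_ifs with hd
    · exact one_pos
    · exact sum_pos (fun k _ => (branch k).leaves_pos) ⟨⟨0, Nat.pos_of_ne_zero hd⟩, mem_univ _⟩

theorem arity_le_leaves (d : {d : ℕ // d ≠ 1}) (branch : Fin d → PTree) :
    d.1 ≤ (mk d branch).leaves := by
  rw [leaves]
  split_ifs with hd
  · omega
  · simpa only [card_univ, Fintype.card_fin, smul_eq_mul, mul_one] using
      card_nsmul_le_sum univ (fun k => (branch k).leaves) 1 fun k _ => (branch k).leaves_pos

theorem leaves_branch_lt (d : {d : ℕ // d ≠ 1}) (branch : Fin d → PTree) (k : Fin d) :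
    (branch k).leaves < (mk d branch).leaves := by
  have two_le : 1 < d.1 := lt_of_le_of_ne (Fin.pos k) d.2.symm
  have : Nontrivial (Fin d) := Fin.nontrivial_iff_two_le.2 two_le
  obtain ⟨j, hj⟩ := exists_ne k
  rw [leaves, if_neg (by omega)]
  exact single_lt_sum (f := fun k => (branch k).leaves) hj (mem_univ k) (mem_univ j) (leaves_pos _)
    fun _ _ _ => Nat.zero_le _

theorem finite_setOf_leaves_le (N : ℕ) : {t : PTree | t.leaves ≤ N}.Finite := by
  induction N with
  | zero => exact Set.finite_empty.subset fun t ht => (t.leaves_pos.not_ge ht).elim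
  | succ N ih =>
    have finite_mk : (⋃ d ∈ {d : {d : ℕ // d ≠ 1} | d.1 ≤ N + 1},
        mk d '' Set.pi Set.univ fun _ => {t | t.leaves ≤ N}).Finite :=
      ((Set.finite_le_nat (N + 1)).preimage Subtype.val_injective.injOn).biUnion
        fun d _ => (Set.Finite.pi fun _ => ih).image _
    refine finite_mk.subset ?_
    rintro ⟨d, branch⟩ ht
    simp only [Set.mem_iUnion]
    exact ⟨d, (arity_le_leaves d branch).trans ht, branch,
      fun k _ => Nat.le_of_lt_succ ((leaves_branch_lt d branch k).trans_le ht), rfl⟩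

end PTree

section TreeSeries

variable {n : ℕ} {R : Type*} [CommRing R] (F : Fin n → MvPowerSeries (Fin n) R)

/-- The factor of a vertex of a tree, given its index `l` and the multiplicities `q` of the indices
of its children: `Y_l` for a leaf, a coefficient of `H_l` otherwise. -/
def vertexFactor (l : Fin n) (q : Fin n →₀ ℕ) : MvPowerSeries (Fin n) R :=
  if q = 0 then X l else C (tensorCoeff (nonlin F l) q)

/-- The amplitude of a planar tree whose root is attached to an external half-line of index `i`. -/
def PTree.amp : PTree → Fin n → MvPowerSeries (Fin n) R
  | mk d branch, i => ∑ l, C ((linMatrix F)⁻¹ i l) *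
      ∑ ks : Fin d → Fin n, vertexFactor F l (mult ks) * ∏ k, (branch k).amp (ks k)

theorem natCast_le_order_sum {σ ι : Type*} {s : Finset ι} {f : ι → MvPowerSeries σ R} {N : ℕ}
    (h : ∀ i ∈ s, (N : ℕ∞) ≤ (f i).order) : (N : ℕ∞) ≤ (∑ i ∈ s, f i).order := by
  refine nat_le_order fun d hd => ?_
  rw [map_sum]
  exact sum_eq_zero fun i hi =>
    coeff_of_lt_order (lt_of_lt_of_le (by exact_mod_cast hd) (h i hi))

theorem mult_eq_zero_iff {d : ℕ} (ks : Fin d → Fin n) : mult ks = 0 ↔ d = 0 := by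
  rw [← Finsupp.degree_eq_zero_iff, degree_mult]

theorem PTree.leaves_le_order_amp (t : PTree) (i : Fin n) :
    (t.leaves : ℕ∞) ≤ (t.amp F i).order := by
  induction t generalizing i with
  | mk d branch ih =>
    rw [amp]
    refine natCast_le_order_sum fun l _ => le_trans (le_add_left ?_) le_order_mul
    refine natCast_le_order_sum fun ks _ => le_trans ?_ le_order_mul
    rw [leaves]
    split_ifs with hd
    · refine le_add_right ?_
      rw [vertexFactor, if_pos ((mult_eq_zero_iff ks).2 hd), Nat.cast_one,
        one_le_order_iff_constCoeff_eq_zero, constantCoeff_X]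
    · rw [Nat.cast_sum]
      exact le_add_left ((sum_le_sum fun k _ => ih k _).trans (le_order_prod _ _))

theorem sum_vertexFactor_one (l : Fin n) (G : Fin n → MvPowerSeries (Fin n) R) :
    ∑ ks : Fin 1 → Fin n, vertexFactor F l (mult ks) * ∏ k, G (ks k) = 0 :=
  sum_eq_zero fun ks _ => by
    rw [vertexFactor, if_neg (by simp [mult_eq_zero_iff]), tensorCoeff, coeff_nonlin, degree_mult]
    simp

variable [Algebra ℚ R]

theorem PTree.coeff_weight_smul_amp_eq_zero {t : PTree} {a : Fin n →₀ ℕ}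
    (h : a.degree < t.leaves) (i : Fin n) : coeff a (t.weight • t.amp F i) = 0 := by
  have lt_order : (a.degree : ℕ∞) < (t.amp F i).order :=
    lt_of_lt_of_le (by exact_mod_cast h) (t.leaves_le_order_amp F i)
  rw [Algebra.smul_def, MvPowerSeries.algebraMap_apply, coeff_C_mul, coeff_of_lt_order lt_order,
    mul_zero]

theorem inv_factorial_smul_sum_vertexFactor (d : ℕ) (l : Fin n)
    (G : Fin n → MvPowerSeries (Fin n) R) :
    (d.factorial : ℚ)⁻¹ • ∑ ks : Fin d → Fin n, vertexFactor F l (mult ks) * ∏ k, G (ks k) =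
      ∑ q ∈ finsuppAntidiag univ d, ((if q = 0 then X l else 0) +
        C (coeff q (nonlin F l)) * q.prod fun j e => G j ^ e) := by
  simp only [prod_comp_eq_mult_prod]
  rw [inv_factorial_smul_sum_comp_mult fun q => vertexFactor F l q * q.prod fun j e => G j ^ e]
  refine sum_congr rfl fun q _ => ?_
  rw [vertexFactor]
  split_ifs with hq
  · simp [hq, coeff_nonlin]
  · have factorials : algebraMap ℚ R (∏ j, (q j).factorial : ℚ)⁻¹ *
        ∏ j, ((q j).factorial : R) = 1 := by
      rw [show ∏ j, ((q j).factorial : R) = algebraMap ℚ R (∏ j, ((q j).factorial : ℚ)) by simp,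
        ← map_mul, inv_mul_cancel₀ (by positivity), map_one]
    rw [zero_add, ← smul_mul_assoc, Algebra.smul_def, MvPowerSeries.algebraMap_apply, ← map_mul,
      tensorCoeff, ← mul_assoc, factorials, one_mul]

theorem PTree.weight_smul_amp_mk (d : {d : ℕ // d ≠ 1}) (branch : Fin d → PTree) (i : Fin n) :
    (mk d branch).weight • (mk d branch).amp F i = ∑ l, C ((linMatrix F)⁻¹ i l) *
      ((d.1.factorial : ℚ)⁻¹ • ∑ ks : Fin d → Fin n,
        vertexFactor F l (mult ks) * ∏ k, (branch k).weight • (branch k).amp F (ks k)) := by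
  rw [weight, amp, smul_sum]
  refine sum_congr rfl fun l _ => ?_
  rw [mul_smul, ← mul_smul_comm, ← mul_smul_comm, smul_sum]
  congr 2
  refine sum_congr rfl fun ks _ => ?_
  simp only [Algebra.smul_def, map_prod, prod_mul_distrib]
  ring

variable [UniformSpace R] [DiscreteUniformity R]

theorem summable_weight_smul_amp (i : Fin n) : Summable fun t : PTree => t.weight • t.amp F i :=
  (summableFamily_iff_summable _).1 fun a =>
    (PTree.finite_setOf_leaves_le a.degree).subset fun _ ht =>
      not_lt.1 fun h => ht (PTree.coeff_weight_smul_amp_eq_zero F h i)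

/-- The sum of the weighted amplitudes of all planar trees. -/
def treeSeries (i : Fin n) : MvPowerSeries (Fin n) R := ∑' t : PTree, t.weight • t.amp F i

theorem hasSum_treeSeries (i : Fin n) :
    HasSum (fun t : PTree => t.weight • t.amp F i) (treeSeries F i) :=
  (summable_weight_smul_amp F i).hasSum

theorem constantCoeff_treeSeries (i : Fin n) : constantCoeff (treeSeries F i) = 0 := by
  rw [← coeff_zero_eq_constantCoeff_apply,
    ← (WithPiTopology.hasSum_iff_hasSum_coeff.1 (hasSum_treeSeries F i) 0).tsum_eq]
  exact (tsum_congr fun t => PTree.coeff_weight_smul_amp_eq_zero F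
    (by simpa using t.leaves_pos) i).trans tsum_zero

theorem hasSum_weight_smul_amp_mk (i : Fin n) (d : {d : ℕ // d ≠ 1}) :
    HasSum (fun branch : Fin d → PTree =>
        (PTree.mk d branch).weight • (PTree.mk d branch).amp F i)
      (∑ l, C ((linMatrix F)⁻¹ i l) * ((d.1.factorial : ℚ)⁻¹ •
        ∑ ks : Fin d → Fin n, vertexFactor F l (mult ks) * ∏ k, treeSeries F (ks k))) := by
  simp only [PTree.weight_smul_amp_mk, Algebra.smul_def (d.1.factorial : ℚ)⁻¹]
  have branches (ks : Fin d → Fin n) :=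
    hasSum_prod_pi fun k => hasSum_treeSeries F (ks k)
  exact hasSum_sum fun l _ =>
    ((hasSum_sum fun ks _ => (branches ks).mul_left _).mul_left _).mul_left _

theorem hasSum_vertexFactor (l : Fin n) {G : Fin n → MvPowerSeries (Fin n) R}
    (hG : ∀ j, constantCoeff (G j) = 0) :
    HasSum (fun d : {d : ℕ // d ≠ 1} => (d.1.factorial : ℚ)⁻¹ •
        ∑ ks : Fin d → Fin n, vertexFactor F l (mult ks) * ∏ k, G (ks k))
      (X l + (nonlin F l).subst G) := by
  classical
  have by_exponent := (hasSum_ite_eq (0 : Fin n →₀ ℕ) (X l : MvPowerSeries (Fin n) R)).add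
    (hasSum_subst (hasSubst_of_constantCoeff_zero hG) (nonlin F l))
  have by_degree := hasSum_sum_finsuppAntidiag by_exponent
  simp only [← inv_factorial_smul_sum_vertexFactor] at by_degree
  rw [← (Subtype.val_injective (p := fun d : ℕ => d ≠ 1)).hasSum_iff] at by_degree
  · exact by_degree
  · intro d hd
    obtain rfl : d = 1 := by simpa using hd
    rw [sum_vertexFactor_one, smul_zero]

theorem treeSeries_eq (i : Fin n) : treeSeries F i = ∑ l, C ((linMatrix F)⁻¹ i l) *
    (X l + (nonlin F l).subst (treeSeries F)) := by
  have by_arity := hasSum_treeSeries F i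
  rw [← PTree.equivSigma.hasSum_iff] at by_arity
  exact (by_arity.sigma fun d => hasSum_weight_smul_amp_mk F i d).unique
    (hasSum_sum fun l _ => (hasSum_vertexFactor F l (constantCoeff_treeSeries F)).mul_left _)

end TreeSeries

/-! ### Rooted parent maps -/

section ParentMap

variable {V : Type*} {par : V → Option V}

/-- The digraph of a parent map: its vertices are those of `V` and a root `none`, and a link goes
from each `x` to its parent. -/
def parentDigraph (par : V → Option V) : Digraph (Option V) where
  Adj o o' := ∃ x, o = some x ∧ par x = o'

/-- `dep` counts the steps from a vertex to the root along the parent map; the existence of such a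
function says that every vertex descends from the root. -/
def IsDepth (par : V → Option V) (dep : Option V → ℕ) : Prop :=
  dep none = 0 ∧ ∀ x, dep (some x) = dep (par x) + 1

theorem exists_isDepth_of_iterate_eq_none (h : ∀ o, ∃ k, (Option.bind · par)^[k] o = none) :
    ∃ dep, IsDepth par dep := by
  classical
  refine ⟨fun o => Nat.find (h o), (Nat.find_eq_zero _).2 rfl, fun x => ?_⟩
  rw [Nat.find_eq_iff]
  refine ⟨?_, ?_⟩
  · rw [Function.iterate_succ_apply]
    exact Nat.find_spec (h (par x))
  · rintro (_ | k) hk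
    · exact Option.some_ne_none x
    · rw [Function.iterate_succ_apply]
      exact Nat.find_min (h (par x)) (Nat.lt_of_succ_lt_succ hk)

theorem parentDigraph_toSimpleGraphInclusive_adj {o o' : Option V} :
    (parentDigraph par).toSimpleGraphInclusive.Adj o o' ↔
      o ≠ o' ∧ ((∃ x, o = some x ∧ par x = o') ∨ ∃ x, o' = some x ∧ par x = o) :=
  SimpleGraph.fromRel_adj _ _ _

theorem exists_isDepth_of_connected (h : (parentDigraph par).toSimpleGraphInclusive.Connected) :
    ∃ dep, IsDepth par dep := by
  refine exists_isDepth_of_iterate_eq_none fun o => ?_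
  have hreach := (SimpleGraph.reachable_iff_reflTransGen _ _).1 (h.preconnected none o)
  induction hreach with
  | refl => exact ⟨0, rfl⟩
  | tail _ hadj ih =>
    obtain ⟨k, hk⟩ := ih
    rcases (parentDigraph_toSimpleGraphInclusive_adj.1 hadj).2 with ⟨x, rfl, rfl⟩ | ⟨x, rfl, rfl⟩
    · cases k with
      | zero => cases hk
      | succ k => exact ⟨k, hk⟩
    · exact ⟨k + 1, hk⟩

namespace IsDepth

variable {dep : Option V → ℕ}

theorem adj_parent (h : IsDepth par dep) (x : V) :
    (parentDigraph par).toSimpleGraphInclusive.Adj (some x) (par x) := by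
  refine parentDigraph_toSimpleGraphInclusive_adj.2 ⟨fun hx => ?_, Or.inl ⟨x, rfl, rfl⟩⟩
  exact absurd (h.2 x) (by rw [← hx]; simp)

theorem exists_walk_length_eq (h : IsDepth par dep) (o : Option V) :
    ∃ p : (parentDigraph par).toSimpleGraphInclusive.Walk o none, p.length = dep o := by
  induction hk : dep o generalizing o with
  | zero =>
    cases o with
    | none => exact ⟨.nil, rfl⟩
    | some x => exact absurd hk (by simp [h.2])
  | succ k ih =>
    cases o with
    | none => exact absurd hk (by simp [h.1])
    | some x =>
      obtain ⟨p, hp⟩ := ih (par x) (by have := h.2 x; lia)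
      exact ⟨.cons (h.adj_parent x) p, by rw [SimpleGraph.Walk.length_cons, hp]⟩

theorem connected (h : IsDepth par dep) :
    (parentDigraph par).toSimpleGraphInclusive.Connected := by
  refine ⟨fun o o' => ?_⟩
  obtain ⟨p, -⟩ := h.exists_walk_length_eq o
  obtain ⟨p', -⟩ := h.exists_walk_length_eq o'
  exact ⟨p.append p'.reverse⟩

theorem le_add_length (h : IsDepth par dep) {o o' : Option V}
    (p : (parentDigraph par).toSimpleGraphInclusive.Walk o o') : dep o ≤ dep o' + p.length := by
  induction p with
  | nil => simp
  | cons hadj p ih =>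
    rw [SimpleGraph.Walk.length_cons]
    rcases (parentDigraph_toSimpleGraphInclusive_adj.1 hadj).2 with ⟨x, rfl, rfl⟩ | ⟨x, rfl, rfl⟩
    all_goals have := h.2 x; lia

theorem dist_none (h : IsDepth par dep) (o : Option V) :
    (parentDigraph par).toSimpleGraphInclusive.dist o none = dep o := by
  obtain ⟨p, hp⟩ := h.exists_walk_length_eq o
  obtain ⟨q, hq⟩ := p.reachable.exists_walk_length_eq_dist
  refine le_antisymm (hp ▸ SimpleGraph.dist_le p) ?_
  simpa [h.1, hq] using h.le_add_length q

theorem isTree [Finite V] (h : IsDepth par dep) :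
    (parentDigraph par).toSimpleGraphInclusive.IsTree := by
  rw [SimpleGraph.isTree_iff_connected_and_card]
  refine ⟨h.connected, le_antisymm ?_ h.connected.card_vert_le_card_edgeSet_add_one⟩
  rw [Finite.card_option]
  refine Nat.succ_le_succ (Nat.card_le_card_of_surjective
    (fun x => (⟨s(some x, par x), h.adj_parent x⟩ :
      (parentDigraph par).toSimpleGraphInclusive.edgeSet)) ?_)
  rintro ⟨e, he⟩
  induction e with
  | _ o o' =>
    rcases (parentDigraph_toSimpleGraphInclusive_adj.1 he).2 with ⟨x, rfl, rfl⟩ | ⟨x, rfl, rfl⟩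
    · exact ⟨x, rfl⟩
    · exact ⟨x, Subtype.ext Sym2.eq_swap⟩

theorem induction_parent (h : IsDepth par dep) {p : V → Prop}
    (step : ∀ x, (∀ y, par x = some y → p y) → p x) (x : V) : p x := by
  induction hk : dep (some x) using Nat.strong_induction_on generalizing x with
  | _ k ih =>
    refine step x fun y hy => ih _ ?_ y rfl
    have := h.2 x
    rw [hy] at this
    lia

theorem induction_children [Finite V] (h : IsDepth par dep) {p : V → Prop}
    (step : ∀ x, (∀ y, par y = some x → p y) → p x) (x : V) : p x := by
  obtain ⟨B, hB⟩ := Set.Finite.bddAbove (Set.finite_range fun x => dep (some x))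
  induction hk : B - dep (some x) using Nat.strong_induction_on generalizing x with
  | _ k ih =>
    refine step x fun y hy => ih _ ?_ y rfl
    have := h.2 y
    rw [hy] at this
    have := hB ⟨y, rfl⟩
    lia

end IsDepth

end ParentMap

section GraphIso

variable {V W : Type*} {G : SimpleGraph V} {H : SimpleGraph W}

theorem dist_map_le (f : G →g H) {u v : V} (huv : G.Reachable u v) :
    H.dist (f u) (f v) ≤ G.dist u v := by
  obtain ⟨p, hp⟩ := huv.exists_walk_length_eq_dist
  rw [← hp, ← SimpleGraph.Walk.length_map f]
  exact SimpleGraph.dist_le _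

theorem dist_map_iso (hG : G.Connected) (φ : G ≃g H) (u v : V) :
    H.dist (φ u) (φ v) = G.dist u v := by
  refine le_antisymm (dist_map_le φ.toHom (hG.preconnected u v)) ?_
  simpa using dist_map_le φ.symm.toHom ((φ.connected_iff.1 hG).preconnected (φ u) (φ v))

end GraphIso

/-! ### Diagrams with a single `u`-source are presented by parent maps -/

section Block

variable {E V : Type*} [Fintype V] [DecidableEq V] (par : V → Option V) (f : V ⊕ V ≃ E)

/-- The block of half-lines at the vertex `x` of a parent map: its `ū`-half-line `f (.inl x)` and
the `u`-half-lines `f (.inr y)` of its children `y`. -/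
def block (x : V) : Finset E :=
  (({x} : Finset V).disjSum {y | par y = some x}).map f.toEmbedding

variable {par f}

@[simp] theorem inl_mem_block {x y : V} : f (.inl y) ∈ block par f x ↔ y = x := by
  simp [block]

@[simp] theorem inr_mem_block {x y : V} : f (.inr y) ∈ block par f x ↔ par y = some x := by
  simp [block]

theorem block_injective : Function.Injective (block par f) := fun x y hxy =>
  inl_mem_block.1 (hxy ▸ inl_mem_block.2 rfl : f (.inl x) ∈ block par f y)

variable [DecidableEq E]

theorem block_inter_map_inl (x : V) :
    block par f x ∩ univ.map (.trans .inl f.toEmbedding) = {f (.inl x)} := by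
  ext e
  obtain ⟨y | y, rfl⟩ := f.surjective e <;> simp

theorem block_inter_map_inr (x : V) : block par f x ∩ univ.map (.trans .inr f.toEmbedding) =
    ({y | par y = some x} : Finset V).map (.trans .inr f.toEmbedding) := by
  ext e
  obtain ⟨y | y, rfl⟩ := f.surjective e <;> simp

end Block

namespace Feynman

variable {E : Type*} [Fintype E] [DecidableEq E]

section General

variable {I J : Type*} (D : Feynman I J E) {e : E} {B : Finset E}

theorem mem_Eu_iff : e ∈ D.Eu ↔ e ∉ D.Eubar := by
  rw [D.isCompl_u_ubar.eq_compl, Finset.mem_compl]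

theorem mem_Eint_iff : e ∈ D.Eint ↔ e ∉ D.Eext := by
  rw [D.isCompl_int_ext.eq_compl, Finset.mem_compl]

theorem existsUnique_block (h : e ∈ D.Eint) : ∃! B, B ∈ D.piH ∪ D.piY ∧ e ∈ B := by
  obtain ⟨P, hP⟩ := D.partition_int
  exact hP ▸ P.existsUnique_mem h

theorem block_subset_Eint (hB : B ∈ D.piH ∪ D.piY) : B ⊆ D.Eint := by
  obtain ⟨P, hP⟩ := D.partition_int
  exact P.le (hP ▸ hB)

theorem block_unique {B' : Finset E} (hB : B ∈ D.piH ∪ D.piY) (hB' : B' ∈ D.piH ∪ D.piY)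
    (he : e ∈ B) (he' : e ∈ B') : B = B' :=
  (D.existsUnique_block (D.block_subset_Eint hB he)).unique ⟨hB, he⟩ ⟨hB', he'⟩

theorem existsUnique_ubar_mem_block (hB : B ∈ D.piH ∪ D.piY) :
    ∃! x : {x // x ∈ D.Eubar}, x.1 ∈ B := by
  have hcard : (B ∩ D.Eubar).card = 1 :=
    (Finset.mem_union.1 hB).elim (fun h => (D.H_vertex B h).1) fun h => (D.Y_vertex B h).1
  obtain ⟨x, hx⟩ := Finset.card_eq_one.1 hcard
  have mem_iff (y : E) : y ∈ B ∧ y ∈ D.Eubar ↔ y = x := by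
    rw [← Finset.mem_inter, hx, Finset.mem_singleton]
  exact ⟨⟨x, ((mem_iff x).2 rfl).2⟩, ((mem_iff x).2 rfl).1,
    fun y hy => Subtype.ext ((mem_iff y).1 ⟨hy, y.2⟩)⟩

theorem notMem_Eu_of_mem_piY (hB : B ∈ D.piY) (he : e ∈ B) : e ∉ D.Eu := fun heu =>
  Finset.notMem_empty e ((D.Y_vertex B hB).2 ▸ Finset.mem_inter.2 ⟨he, heu⟩)

end General

variable (D : Feynman (Fin 1) Empty E)

theorem rhoU_mem_Eu : D.rhoU 0 ∈ D.Eu :=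
  (Finset.mem_inter.1 (D.bijOn_rhoU.mapsTo (Set.mem_univ 0))).2

theorem mem_Eext_iff {e : E} : e ∈ D.Eext ↔ e = D.rhoU 0 := by
  refine ⟨fun he => ?_, fun he => ?_⟩
  · by_cases hbar : e ∈ D.Eubar
    · obtain ⟨j, -, -⟩ := D.bijOn_rhoUbar.surjOn (Finset.mem_coe.2 (Finset.mem_inter.2 ⟨he, hbar⟩))
      exact j.elim
    · obtain ⟨i, -, hi⟩ := D.bijOn_rhoU.surjOn
        (Finset.mem_coe.2 (Finset.mem_inter.2 ⟨he, D.mem_Eu_iff.2 hbar⟩))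
      rw [← hi, Subsingleton.elim i 0]
  · exact he ▸ (Finset.mem_inter.1 (D.bijOn_rhoU.mapsTo (Set.mem_univ 0))).1

theorem mem_Eint_of_mem_Eubar {e : E} (he : e ∈ D.Eubar) : e ∈ D.Eint := by
  rw [mem_Eint_iff, mem_Eext_iff]
  rintro rfl
  exact D.mem_Eu_iff.1 D.rhoU_mem_Eu he

/-- The parent map `par` on `V` presents the diagram `D`: the elements of `V` are the vertices of
`D` other than the `u`-source `none`, the half-line `f (.inl x)` is the `ū`-half-line of the vertex
`x` and `f (.inr x)` is the `u`-half-line contracted with it, which belongs to the parent of `x`. -/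
structure IsPresentation {V : Type*} [Fintype V] [DecidableEq V] (par : V → Option V)
    (f : V ⊕ V ≃ E) : Prop where
  inl_mem : ∀ x, f (.inl x) ∈ D.Eubar
  inr_mem : ∀ x, f (.inr x) ∈ D.Eu
  contr : ∀ x, (D.contr ⟨f (.inl x), inl_mem x⟩ : E) = f (.inr x)
  root : ∀ x, f (.inr x) = D.rhoU 0 ↔ par x = none
  mem_piH : ∀ B, B ∈ D.piH ↔ ∃ x, (∃ y, par y = some x) ∧ block par f x = B
  mem_piY : ∀ B, B ∈ D.piY ↔ ∃ x, (¬ ∃ y, par y = some x) ∧ block par f x = B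

/-- The `ū`-half-lines, and the `u`-half-lines indexed by the `ū`-half-lines contracted with
them. -/
def halfLines : {x // x ∈ D.Eubar} ⊕ {x // x ∈ D.Eubar} ≃ E :=
  (Equiv.sumCongr (Equiv.refl _)
    (D.contr.trans (Equiv.subtypeEquivRight fun _ => D.mem_Eu_iff))).trans (Equiv.sumCompl _)

@[simp] theorem halfLines_inl (x : {x // x ∈ D.Eubar}) : D.halfLines (.inl x) = x := rfl

@[simp] theorem halfLines_inr (x : {x // x ∈ D.Eubar}) : D.halfLines (.inr x) = D.contr x := rfl

open Classical in
/-- The parent map of a diagram with one `u`-source, whose vertices are represented by their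
`ū`-half-lines: the parent of `y` is the `H`-vertex containing the half-line contracted with `y`,
and `none` if that half-line is the `u`-source. -/
def parent (y : {x // x ∈ D.Eubar}) : Option {x // x ∈ D.Eubar} :=
  if h : ∃ x : {x // x ∈ D.Eubar}, ∃ B ∈ D.piH, x.1 ∈ B ∧ (D.contr y : E) ∈ B then some h.choose
  else none

section Parent

variable {D} {x y : {x // x ∈ D.Eubar}} {B : Finset E}

theorem parent_eq_some_iff :
    D.parent y = some x ↔ ∃ B ∈ D.piH, x.1 ∈ B ∧ (D.contr y : E) ∈ B := by
  unfold parent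
  split_ifs with h
  · obtain ⟨B', hB', hx', hy'⟩ := h.choose_spec
    rw [Option.some_inj]
    refine ⟨fun hx => hx ▸ h.choose_spec, fun ⟨B, hB, hx, hy⟩ => ?_⟩
    obtain rfl := D.block_unique (Finset.mem_union_left _ hB) (Finset.mem_union_left _ hB') hy hy'
    exact (D.existsUnique_ubar_mem_block (Finset.mem_union_left _ hB)).unique hx' hx
  · exact iff_of_false (by simp) fun hx => h ⟨x, hx⟩

theorem parent_eq_some_iff_mem (hB : B ∈ D.piH ∪ D.piY) (hx : x.1 ∈ B) :
    D.parent y = some x ↔ (D.contr y : E) ∈ B := by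
  rw [parent_eq_some_iff]
  refine ⟨fun ⟨B', hB', hx', hy⟩ => ?_, fun hy => ?_⟩
  · rwa [D.block_unique hB (Finset.mem_union_left _ hB') hx hx']
  · refine ⟨B, (Finset.mem_union.1 hB).resolve_right fun hBY => ?_, hx, hy⟩
    exact D.notMem_Eu_of_mem_piY hBY hy (D.contr y).2

theorem block_parent (hB : B ∈ D.piH ∪ D.piY) (hx : x.1 ∈ B) :
    block D.parent D.halfLines x = B := by
  ext e
  obtain ⟨z, rfl⟩ := D.halfLines.surjective e
  rcases z with y | y
  · rw [inl_mem_block, halfLines_inl]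
    exact ⟨fun hyx => hyx ▸ hx,
      fun hy => (D.existsUnique_ubar_mem_block hB).unique hy hx⟩
  · rw [inr_mem_block, halfLines_inr, parent_eq_some_iff_mem hB hx]

theorem mem_piH_iff_exists_parent_eq (hB : B ∈ D.piH ∪ D.piY) (hx : x.1 ∈ B) :
    B ∈ D.piH ↔ ∃ y, D.parent y = some x := by
  refine ⟨fun hBH => ?_, fun ⟨y, hy⟩ => ?_⟩
  · obtain ⟨e, he⟩ := Finset.card_pos.1 (two_pos.trans_le (D.H_vertex B hBH).2)
    rw [Finset.mem_inter] at he
    exact ⟨D.contr.symm ⟨e, he.2⟩, (parent_eq_some_iff_mem hB hx).2 (by simpa using he.1)⟩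
  · refine (Finset.mem_union.1 hB).resolve_right fun hBY => ?_
    exact D.notMem_Eu_of_mem_piY hBY ((parent_eq_some_iff_mem hB hx).1 hy) (D.contr y).2

theorem contr_eq_rhoU_iff : (D.contr y : E) = D.rhoU 0 ↔ D.parent y = none := by
  rw [← mem_Eext_iff, ← not_iff_not, ← mem_Eint_iff, ← ne_eq, Option.ne_none_iff_exists']
  refine ⟨fun hy => ?_, fun ⟨x, hx⟩ => ?_⟩
  · obtain ⟨B, ⟨hB, hyB⟩, -⟩ := D.existsUnique_block hy
    obtain ⟨x, hx, -⟩ := D.existsUnique_ubar_mem_block hB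
    exact ⟨x, (parent_eq_some_iff_mem hB hx).2 hyB⟩
  · obtain ⟨B, hB, -, hy⟩ := parent_eq_some_iff.1 hx
    exact D.block_subset_Eint (Finset.mem_union_left _ hB) hy

end Parent

theorem isPresentation_parent : D.IsPresentation D.parent D.halfLines where
  inl_mem x := x.2
  inr_mem x := (D.contr x).2
  contr _ := rfl
  root _ := contr_eq_rhoU_iff
  mem_piH B := by
    refine ⟨fun hB => ?_, fun ⟨x, hx, hxB⟩ => ?_⟩
    · have hB' := Finset.mem_union_left D.piY hB
      obtain ⟨x, hx, -⟩ := D.existsUnique_ubar_mem_block hB'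
      exact ⟨x, (mem_piH_iff_exists_parent_eq hB' hx).1 hB, block_parent hB' hx⟩
    · obtain ⟨B', ⟨hB', hx'⟩, -⟩ := D.existsUnique_block (D.mem_Eint_of_mem_Eubar x.2)
      rw [← hxB, block_parent hB' hx']
      exact (mem_piH_iff_exists_parent_eq hB' hx').2 hx
  mem_piY B := by
    refine ⟨fun hB => ?_, fun ⟨x, hx, hxB⟩ => ?_⟩
    · have hB' := Finset.mem_union_right D.piH hB
      obtain ⟨x, hx, -⟩ := D.existsUnique_ubar_mem_block hB'
      exact ⟨x, fun hc => Finset.disjoint_left.1 D.disjoint_H_Y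
        ((mem_piH_iff_exists_parent_eq hB' hx).2 hc) hB, block_parent hB' hx⟩
    · obtain ⟨B', ⟨hB', hx'⟩, -⟩ := D.existsUnique_block (D.mem_Eint_of_mem_Eubar x.2)
      rw [← hxB, block_parent hB' hx']
      exact (Finset.mem_union.1 hB').resolve_left fun hBH =>
        hx ((mem_piH_iff_exists_parent_eq hB' hx').1 hBH)

namespace IsPresentation

variable {D} {V : Type*} [Fintype V] [DecidableEq V] {par : V → Option V} {f : V ⊕ V ≃ E}
  (h : D.IsPresentation par f)
include h

theorem inr_notMem (x : V) : f (.inr x) ∉ D.Eubar := D.mem_Eu_iff.1 (h.inr_mem x)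

theorem Eubar_eq : D.Eubar = univ.map (.trans .inl f.toEmbedding) := by
  ext e
  obtain ⟨x | x, rfl⟩ := f.surjective e <;> simp [h.inl_mem, h.inr_notMem]

theorem Eu_eq : D.Eu = univ.map (.trans .inr f.toEmbedding) := by
  ext e
  obtain ⟨x | x, rfl⟩ := f.surjective e <;> simp [h.inl_mem, h.inr_notMem, D.mem_Eu_iff]

theorem piH_eq : D.piH = ({x | ∃ y, par y = some x} : Finset V).image (block par f) := by
  ext B
  simp [h.mem_piH]

theorem piY_eq : D.piY = ({x | ¬ ∃ y, par y = some x} : Finset V).image (block par f) := by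
  ext B
  simp [h.mem_piY]

theorem block_inter_Eubar (x : V) : block par f x ∩ D.Eubar = {f (.inl x)} := by
  rw [h.Eubar_eq, block_inter_map_inl]

theorem block_inter_Eu (x : V) :
    block par f x ∩ D.Eu = ({y | par y = some x} : Finset V).map (.trans .inr f.toEmbedding) := by
  rw [h.Eu_eq, block_inter_map_inr]

theorem card_children_ne_one (x : V) : ({y | par y = some x} : Finset V).card ≠ 1 := by
  intro hcard
  obtain ⟨y, hy⟩ := Finset.card_pos.1 (hcard ▸ one_pos)
  have hB := (D.H_vertex _ ((h.mem_piH _).2 ⟨x, ⟨y, by simpa using hy⟩, rfl⟩)).2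
  rw [h.block_inter_Eu, Finset.card_map, hcard] at hB
  lia

theorem existsUnique_root : ∃! r, par r = none := by
  obtain ⟨x | x, hx⟩ := f.surjective (D.rhoU 0)
  · exact absurd (h.inl_mem x) (hx ▸ D.mem_Eu_iff.1 D.rhoU_mem_Eu)
  · refine ⟨x, (h.root x).1 hx, fun y hy => ?_⟩
    exact Sum.inr_injective (f.injective (((h.root y).2 hy).trans hx.symm))

end IsPresentation

end Feynman

/-! ### Connected diagrams with a single `u`-source are tree-like -/

namespace Feynman

variable {E : Type*} [Fintype E] [DecidableEq E] {D : Feynman (Fin 1) Empty E}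

theorem mem_uSources {a : Finset E} : a ∈ D.uSources ↔ a = {D.rhoU 0} := by
  simp only [uSources, Finset.mem_image, Finset.mem_inter, D.mem_Eext_iff]
  refine ⟨?_, fun ha => ⟨_, ⟨rfl, D.rhoU_mem_Eu⟩, ha.symm⟩⟩
  rintro ⟨e, ⟨rfl, -⟩, rfl⟩
  rfl

theorem ubarSources_eq_empty : D.ubarSources = ∅ := by
  rw [ubarSources, Finset.image_eq_empty, Finset.eq_empty_iff_forall_notMem]
  intro e he
  exact D.mem_Eint_iff.1 (D.mem_Eint_of_mem_Eubar (Finset.mem_inter.1 he).2)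
    (Finset.mem_inter.1 he).1

namespace IsPresentation

variable {V : Type*} [Fintype V] [DecidableEq V] {par : V → Option V} {f : V ⊕ V ≃ E}
  (h : D.IsPresentation par f)

/-- The vertices of the digraph of a presented diagram: the `u`-source and the blocks. -/
def vertex : Option V → D.Vertex
  | none => ⟨{D.rhoU 0}, by simp [mem_uSources]⟩
  | some x => ⟨block par f x, by
      by_cases hx : ∃ y, par y = some x
      · exact Finset.mem_union_left _ (Finset.mem_union_right _ ((h.mem_piH _).2 ⟨x, hx, rfl⟩))
      · exact Finset.mem_union_right _ ((h.mem_piY _).2 ⟨x, hx, rfl⟩)⟩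

include h

theorem inl_mem_vertex {x : V} {o : Option V} : f (.inl x) ∈ (h.vertex o).1 ↔ o = some x := by
  cases o with
  | none =>
    refine iff_of_false (fun hx => ?_) (by simp)
    exact D.mem_Eu_iff.1 D.rhoU_mem_Eu (Finset.mem_singleton.1 hx ▸ h.inl_mem x)
  | some y => rw [vertex, inl_mem_block, Option.some_inj, eq_comm]

theorem inr_mem_vertex {x : V} {o : Option V} : f (.inr x) ∈ (h.vertex o).1 ↔ par x = o := by
  cases o with
  | none => rw [vertex, Finset.mem_singleton, h.root]
  | some y => rw [vertex, inr_mem_block]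

theorem vertex_bijective : Function.Bijective h.vertex := by
  refine ⟨fun o o' hoo' => Option.ext fun x => ?_, fun ⟨a, ha⟩ => ?_⟩
  · rw [← h.inl_mem_vertex, ← h.inl_mem_vertex, hoo']
  · simp only [Finset.mem_union, mem_uSources, ubarSources_eq_empty, Finset.notMem_empty, or_false,
      h.mem_piH, h.mem_piY] at ha
    rcases ha with (rfl | ⟨x, -, rfl⟩) | ⟨x, -, rfl⟩
    exacts [⟨none, rfl⟩, ⟨some x, rfl⟩, ⟨some x, rfl⟩]

theorem digraph_adj_vertex {o o' : Option V} :
    D.digraph.Adj (h.vertex o) (h.vertex o') ↔ (parentDigraph par).Adj o o' := by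
  constructor
  · rintro ⟨⟨e, he⟩, hmem, hmem'⟩
    obtain ⟨x | x, rfl⟩ := f.surjective e
    · rw [h.contr, h.inr_mem_vertex] at hmem'
      exact ⟨x, h.inl_mem_vertex.1 hmem, hmem'⟩
    · exact absurd he (h.inr_notMem x)
  · rintro ⟨x, rfl, rfl⟩
    exact ⟨⟨_, h.inl_mem x⟩, h.inl_mem_vertex.2 rfl, (h.contr x).symm ▸ h.inr_mem_vertex.2 rfl⟩

/-- The graph of a presented diagram is the graph of its parent map. -/
def graphIso : (parentDigraph par).toSimpleGraphInclusive ≃g D.graph where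
  toEquiv := Equiv.ofBijective h.vertex h.vertex_bijective
  map_rel_iff' := by
    simp [graph, Digraph.toSimpleGraphInclusive, h.digraph_adj_vertex,
      h.vertex_bijective.injective.eq_iff]

theorem exists_isDepth_iff_connected : (∃ dep, IsDepth par dep) ↔ D.Connected := by
  rw [Connected, ← h.graphIso.connected_iff]
  exact ⟨fun ⟨dep, hdep⟩ => hdep.connected, exists_isDepth_of_connected⟩

theorem dist_vertex {dep : Option V → ℕ} (hdep : IsDepth par dep) (o : Option V) :
    D.graph.dist (h.vertex o) (h.vertex none) = dep o :=
  (dist_map_iso hdep.connected h.graphIso o none).trans (hdep.dist_none o)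

theorem exists_two_children {x y : V} (hy : par y = some x) :
    ∃ y' ≠ y, par y' = some x := by
  have hpos : 0 < ({y | par y = some x} : Finset V).card :=
    Finset.card_pos.2 ⟨y, by simpa using hy⟩
  have hone := h.card_children_ne_one x
  obtain ⟨y', hy', hne⟩ := Finset.exists_mem_ne (Nat.lt_of_le_of_ne hpos hone.symm) y
  exact ⟨y', hne, by simpa using hy'⟩

end IsPresentation

theorem Connected.treeLike (hD : D.Connected) : D.TreeLike := by
  have h := D.isPresentation_parent
  obtain ⟨dep, hdep⟩ := h.exists_isDepth_iff_connected.2 hD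
  refine ⟨h.vertex none, fun a => ?_, h.graphIso.isTree_iff.1 hdep.isTree, fun a b hab => ?_,
    fun a ha hleaf => ?_, fun a ha ⟨b, hba⟩ => ?_⟩
  all_goals obtain ⟨o, rfl⟩ := h.vertex_bijective.surjective a
  · rw [mem_uSources, Subtype.ext_iff]
    rfl
  · obtain ⟨o', rfl⟩ := h.vertex_bijective.surjective b
    obtain ⟨x, rfl, rfl⟩ := h.digraph_adj_vertex.1 hab
    rw [h.dist_vertex hdep, h.dist_vertex hdep, hdep.2]
  · obtain ⟨x, rfl⟩ := Option.ne_none_iff_exists'.1 (ne_of_apply_ne h.vertex ha)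
    refine Finset.mem_union_left _ ((h.mem_piY _).2 ⟨x, fun ⟨y, hy⟩ => ?_, rfl⟩)
    exact hleaf _ (h.digraph_adj_vertex.2 ⟨y, rfl, hy⟩)
  · obtain ⟨x, rfl⟩ := Option.ne_none_iff_exists'.1 (ne_of_apply_ne h.vertex ha)
    obtain ⟨o', rfl⟩ := h.vertex_bijective.surjective b
    obtain ⟨y, rfl, hy⟩ := h.digraph_adj_vertex.1 hba
    obtain ⟨y', hne, hy'⟩ := h.exists_two_children hy
    refine ⟨(h.mem_piH _).2 ⟨x, ⟨y, hy⟩, rfl⟩, h.vertex (some y'), h.vertex (some y), ?_,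
      h.digraph_adj_vertex.2 ⟨y', rfl, hy'⟩, hba⟩
    exact h.vertex_bijective.injective.ne (Option.some_injective _ |>.ne hne)

theorem leavesAreY (D : Feynman (Fin 1) Empty E) : D.LeavesAreY := by
  intro a hleaf
  have h := D.isPresentation_parent
  obtain ⟨o, rfl⟩ := h.vertex_bijective.surjective a
  cases o with
  | none =>
    obtain ⟨r, hr, -⟩ := h.existsUnique_root
    exact absurd (h.digraph_adj_vertex.2 ⟨r, rfl, hr⟩) (hleaf _)
  | some x =>
    exact (h.mem_piY _).2
      ⟨x, fun ⟨y, hy⟩ => hleaf _ (h.digraph_adj_vertex.2 ⟨y, rfl, hy⟩), rfl⟩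

end Feynman

/-! ### Isomorphisms of diagrams are isomorphisms of parent maps -/

section HalfLineMap

variable {E E' V V' : Type*} (f : V ⊕ V ≃ E) (f' : V' ⊕ V' ≃ E') (e : V ≃ V')

/-- The bijection of half-lines induced by a bijection of vertices. -/
def halfLineMap : E ≃ E' := f.symm.trans ((Equiv.sumCongr e e).trans f')

@[simp] theorem halfLineMap_apply (z : V ⊕ V) : halfLineMap f f' e (f z) = f' (z.map e e) := by
  simp [halfLineMap]

variable {f f' e} {par : V → Option V} {par' : V' → Option V'}

theorem parent_map_eq_some_iff (he : ∀ x, par' (e x) = (par x).map e) {x y : V} :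
    par' (e y) = some (e x) ↔ par y = some x := by
  rw [he, ← Option.map_some, (Option.map_injective e.injective).eq_iff]

theorem exists_parent_map_eq_some_iff (he : ∀ x, par' (e x) = (par x).map e) {x : V} :
    (∃ y', par' y' = some (e x)) ↔ ∃ y, par y = some x := by
  simp [e.surjective.exists, parent_map_eq_some_iff he]

variable [Fintype V] [DecidableEq V] [Fintype V'] [DecidableEq V']

theorem map_block (he : ∀ x, par' (e x) = (par x).map e) (x : V) :
    (block par f x).map (halfLineMap f f' e).toEmbedding = block par' f' (e x) := by
  ext z'
  obtain ⟨z, rfl⟩ := (f.trans (halfLineMap f f' e)).surjective z'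
  rw [Equiv.trans_apply, Finset.mem_map_equiv, Equiv.symm_apply_apply]
  rcases z with y | y
  · simp
  · simp [parent_map_eq_some_iff he]

theorem map_image_block [DecidableEq E] [DecidableEq E'] (he : ∀ x, par' (e x) = (par x).map e)
    {S : Finset V} {S' : Finset V'} (hS : ∀ x, e x ∈ S' ↔ x ∈ S) :
    (S.image (block par f)).map (halfLineMap f f' e).finsetCongr.toEmbedding =
      S'.image (block par' f') := by
  obtain rfl : S' = S.image e := by
    ext x'
    obtain ⟨x, rfl⟩ := e.surjective x'
    simp [hS]
  rw [Finset.map_eq_image, Finset.image_image, Finset.image_image]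
  exact Finset.image_congr fun x _ => map_block he x

end HalfLineMap

namespace Feynman.IsPresentation

variable {E E' V V' : Type*} [Fintype E] [DecidableEq E] [Fintype E'] [DecidableEq E']
  [Fintype V] [DecidableEq V] [Fintype V'] [DecidableEq V']
  {D : Feynman (Fin 1) Empty E} {par : V → Option V} {f : V ⊕ V ≃ E}
  {D' : Feynman (Fin 1) Empty E'} {par' : V' → Option V'} {f' : V' ⊕ V' ≃ E'}
  (h : D.IsPresentation par f) (h' : D'.IsPresentation par' f')
include h h'

theorem rhoU_eq_halfLineMap {e : V ≃ V'} (he : ∀ x, par' (e x) = (par x).map e) :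
    D'.rhoU 0 = halfLineMap f f' e (D.rhoU 0) := by
  obtain ⟨r, hr, -⟩ := h.existsUnique_root
  rw [← (h.root r).2 hr, halfLineMap_apply, eq_comm, Sum.map_inr, h'.root, he, hr, Option.map_none]

theorem isIso_halfLineMap {e : V ≃ V'} (he : ∀ x, par' (e x) = (par x).map e) :
    D.IsIso D' (halfLineMap f f' e) where
  Eubar := by
    ext z'
    obtain ⟨z, rfl⟩ := (f.trans (halfLineMap f f' e)).surjective z'
    rw [Equiv.trans_apply, Finset.mem_map_equiv, Equiv.symm_apply_apply, halfLineMap_apply]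
    rcases z with x | x
    · simp [h.inl_mem, h'.inl_mem]
    · simp [h.inr_notMem, h'.inr_notMem]
  Eu := by
    ext z'
    obtain ⟨z, rfl⟩ := (f.trans (halfLineMap f f' e)).surjective z'
    rw [Equiv.trans_apply, Finset.mem_map_equiv, Equiv.symm_apply_apply, halfLineMap_apply]
    rcases z with x | x
    · simp [h.inl_mem, h'.inl_mem, mem_Eu_iff]
    · simp [h.inr_mem, h'.inr_mem]
  Eint := by
    ext z'
    rw [Finset.mem_map_equiv, mem_Eint_iff, mem_Eint_iff, mem_Eext_iff, mem_Eext_iff,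
      h.rhoU_eq_halfLineMap h' he, Equiv.symm_apply_eq]
  Eext := by
    ext z'
    rw [Finset.mem_map_equiv, mem_Eext_iff, mem_Eext_iff, h.rhoU_eq_halfLineMap h' he,
      Equiv.symm_apply_eq]
  piH := by
    rw [h.piH_eq, h'.piH_eq, map_image_block he fun x => ?_]
    simpa using exists_parent_map_eq_some_iff he
  piY := by
    rw [h.piY_eq, h'.piY_eq, map_image_block he fun x => ?_]
    simpa using not_congr (exists_parent_map_eq_some_iff he)
  rhoU := funext fun i => Subsingleton.elim 0 i ▸ h.rhoU_eq_halfLineMap h' he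
  rhoUbar := funext fun j => j.elim
  contr := by
    rintro ⟨z, hz⟩ ⟨z', hz'⟩ hzz'
    obtain ⟨x | x, rfl⟩ := f.surjective z
    · obtain rfl : f' (.inl (e x)) = z' := by simpa using hzz'
      rw [h.contr, h'.contr, halfLineMap_apply, Sum.map_inr]
    · exact absurd hz (h.inr_notMem x)

theorem parent_map_of_isIso {σ : E ≃ E'} (hσ : D.IsIso D' σ) {e : V → V'}
    (hinl : ∀ x, f' (.inl (e x)) = σ (f (.inl x))) (hinr : ∀ x, f' (.inr (e x)) = σ (f (.inr x)))
    (y : V) : par' (e y) = (par y).map e := by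
  cases hy : par y with
  | none => rw [Option.map_none, ← h'.root, hinr, (h.root y).2 hy, hσ.rhoU, Function.comp_apply]
  | some x =>
    have hB : (block par f x).map σ.toEmbedding ∈ D'.piH := by
      rw [hσ.piH]
      exact Finset.mem_map_of_mem _ ((h.mem_piH _).2 ⟨x, ⟨y, hy⟩, rfl⟩)
    obtain ⟨x', -, hx'⟩ := (h'.mem_piH _).1 hB
    have hx : e x = x' := by
      rw [← inl_mem_block (par := par') (f := f'), hx', hinl]
      exact Finset.mem_map_of_mem _ (inl_mem_block.2 rfl)
    rw [Option.map_some, hx, ← inr_mem_block (f := f'), hx', hinr]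
    exact Finset.mem_map_of_mem _ (inr_mem_block.2 hy)

theorem exists_halfLineMap_eq {σ : E ≃ E'} (hσ : D.IsIso D' σ) :
    ∃ e : V ≃ V', (∀ x, par' (e x) = (par x).map e) ∧ halfLineMap f f' e = σ := by
  have hubar (x : V) : ∃ x', f' (.inl x') = σ (f (.inl x)) := by
    have hmem : σ (f (.inl x)) ∈ D'.Eubar :=
      hσ.Eubar ▸ Finset.mem_map_of_mem _ (h.inl_mem x)
    simpa [h'.Eubar_eq] using hmem
  choose e hinl using hubar
  have hinr (x : V) : f' (.inr (e x)) = σ (f (.inr x)) := by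
    rw [← h'.contr, ← h.contr]
    exact hσ.contr _ _ (hinl x).symm
  have hbij : Function.Bijective e := by
    refine ⟨fun x y hxy => ?_, fun x' => ?_⟩
    · exact Sum.inl_injective ((f.trans σ).injective
        ((hinl x).symm.trans ((congrArg _ (congrArg _ hxy)).trans (hinl y))))
    · obtain ⟨x | x, hx⟩ := (f.trans σ).surjective (f' (.inl x'))
      · exact ⟨x, Sum.inl_injective (f'.injective ((hinl x).trans hx))⟩
      · exact absurd (f'.injective ((hinr x).trans hx)) (by simp)
  refine ⟨Equiv.ofBijective e hbij, h.parent_map_of_isIso h' hσ hinl hinr, Equiv.ext fun z => ?_⟩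
  obtain ⟨x | x, rfl⟩ := f.surjective z
  · rw [halfLineMap_apply]
    exact hinl x
  · rw [halfLineMap_apply]
    exact hinr x

theorem card_isIso : Nat.card {σ : E ≃ E' // D.IsIso D' σ} =
    Nat.card {e : V ≃ V' // ∀ x, par' (e x) = (par x).map e} := by
  refine (Nat.card_eq_of_bijective
    (fun e : {e : V ≃ V' // ∀ x, par' (e x) = (par x).map e} =>
      (⟨halfLineMap f f' e.1, h.isIso_halfLineMap h' e.2⟩ : {σ : E ≃ E' // D.IsIso D' σ}))
    ⟨fun e e' hee' => Subtype.ext (Equiv.ext fun x => ?_), fun ⟨σ, hσ⟩ => ?_⟩).symm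
  · have happly := DFunLike.congr_fun (Subtype.ext_iff.1 hee') (f (.inl x))
    simpa using happly
  · obtain ⟨e, he, rfl⟩ := h.exists_halfLineMap_eq h' hσ
    exact ⟨⟨e, he⟩, rfl⟩

end Feynman.IsPresentation

/-! ### The diagram of a parent map -/

section OfParent

variable {E V : Type*} [DecidableEq E] [Fintype V] [DecidableEq V]
  {par : V → Option V} {f : V ⊕ V ≃ E} {r : V}

theorem existsUnique_mem_block (hr : ∀ x, par x = none ↔ x = r) {e : E} (he : e ≠ f (.inr r)) :
    ∃! B, B ∈ univ.image (block par f) ∧ e ∈ B := by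
  obtain ⟨z, rfl⟩ := f.surjective e
  obtain ⟨x, hx⟩ : ∃ x, ∀ x', f z ∈ block par f x' ↔ x' = x := by
    rcases z with y | y
    · exact ⟨y, fun x' => by rw [inl_mem_block, eq_comm]⟩
    · obtain ⟨x, hx⟩ := Option.ne_none_iff_exists'.1 fun hy => he (by rw [(hr y).1 hy])
      exact ⟨x, fun x' => by rw [inr_mem_block, hx, Option.some_inj, eq_comm]⟩
  refine ⟨block par f x, ⟨by simp, (hx x).2 rfl⟩, ?_⟩
  rintro B ⟨hB, hzB⟩
  obtain ⟨x', -, rfl⟩ := Finset.mem_image.1 hB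
  rw [(hx x').1 hzB]

variable [Fintype E]

/-- The blocks of a parent map with root `r` partition the half-lines other than the `u`-half-line
of `r`. -/
def blockPartition (par : V → Option V) (f : V ⊕ V ≃ E) (hr : ∀ x, par x = none ↔ x = r) :
    Finpartition ({f (.inr r)}ᶜ : Finset E) :=
  Finpartition.ofExistsUnique (univ.image (block par f))
    (by
      simp only [Finset.mem_image, Finset.subset_compl_singleton]
      rintro B ⟨x, -, rfl⟩
      simp [(hr r).2 rfl])
    (fun e he => existsUnique_mem_block hr (by simpa using he))
    (by
      simp only [Finset.mem_image, not_exists, not_and]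
      exact fun x _ => Finset.ne_empty_of_mem (inl_mem_block.2 rfl))

/-- The Feynman diagram with half-lines `f`, vertices the blocks of the parent map `par`, and
`u`-source the `u`-half-line of the root `r`. -/
def Feynman.ofParent (par : V → Option V) (f : V ⊕ V ≃ E) (hr : ∀ x, par x = none ↔ x = r)
    (hpar : ∀ x, ({y | par y = some x} : Finset V).card ≠ 1) : Feynman (Fin 1) Empty E where
  Eubar := univ.map (.trans .inl f.toEmbedding)
  Eu := univ.map (.trans .inr f.toEmbedding)
  Eint := {f (.inr r)}ᶜ
  Eext := {f (.inr r)}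
  piH := ({x | ∃ y, par y = some x} : Finset V).image (block par f)
  piY := ({x | ¬ ∃ y, par y = some x} : Finset V).image (block par f)
  rhoU := fun _ => f (.inr r)
  rhoUbar := Empty.elim
  isCompl_u_ubar := by
    rw [← eq_compl_iff_isCompl]
    ext e
    obtain ⟨x | x, rfl⟩ := f.surjective e <;> simp
  isCompl_int_ext := isCompl_compl.symm
  bijOn_rhoU := ⟨fun _ _ => by simp, fun _ _ _ _ _ => Subsingleton.elim _ _,
    fun e he => ⟨0, trivial, by simp_all⟩⟩
  bijOn_rhoUbar := ⟨fun j => j.elim, fun j => j.elim, fun e he => by simp_all⟩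
  disjoint_H_Y := (Finset.disjoint_image block_injective).2
    (Finset.disjoint_filter_filter_not _ _ _)
  partition_int := ⟨blockPartition par f hr, by
    rw [← Finset.image_union, Finset.filter_union_filter_not_eq]
    rfl⟩
  H_vertex := Finset.forall_mem_image.2 fun x hx => by
    rw [block_inter_map_inl, block_inter_map_inr, Finset.card_singleton, Finset.card_map]
    obtain ⟨y, hy⟩ := (Finset.mem_filter.1 hx).2
    have hpos : 0 < ({y | par y = some x} : Finset V).card := Finset.card_pos.2 ⟨y, by simpa⟩
    exact ⟨rfl, (Nat.two_le_iff _).2 ⟨hpos.ne', hpar x⟩⟩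
  Y_vertex := Finset.forall_mem_image.2 fun x hx => by
    rw [block_inter_map_inl, block_inter_map_inr, Finset.card_singleton, Finset.map_eq_empty,
      Finset.filter_eq_empty_iff]
    exact ⟨rfl, fun y _ hy => (Finset.mem_filter.1 hx).2 ⟨y, hy⟩⟩
  contr := (f.symm.trans ((Equiv.sumComm V V).trans f)).subtypeEquiv fun e => by
    obtain ⟨x | x, rfl⟩ := f.surjective e <;> simp

theorem Feynman.isPresentation_ofParent (par : V → Option V) (f : V ⊕ V ≃ E)
    (hr : ∀ x, par x = none ↔ x = r) (hpar : ∀ x, ({y | par y = some x} : Finset V).card ≠ 1) :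
    (ofParent par f hr hpar).IsPresentation par f where
  inl_mem x := by simp [ofParent]
  inr_mem x := by simp [ofParent]
  contr x := by
    change f (f.symm (f (.inl x))).swap = _
    rw [f.symm_apply_apply, Sum.swap_inl]
  root x := by simp [ofParent, hr]
  mem_piH B := by simp [ofParent]
  mem_piY B := by simp [ofParent]

end OfParent

/-! ### Amplitudes in terms of parent maps -/

section Amplitude

variable {V : Type*} [Fintype V] [DecidableEq V] {n : ℕ} {R : Type*} [CommRing R]
  (F : Fin n → MvPowerSeries (Fin n) R)

/-- The contribution to the amplitude of the diagram of the parent map `par` of the indices `a` of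
the `ū`-half-lines and `b` of the `u`-half-lines. -/
def indexTerm (par : V → Option V) (a b : V → Fin n) : MvPowerSeries (Fin n) R :=
  (∏ x, C ((linMatrix F)⁻¹ (b x) (a x))) *
    ∏ x, vertexFactor F (a x) (∑ y with par y = some x, Finsupp.single (b y) 1)

/-- The amplitude of the diagram of the parent map `par` with root `r` and external index `i`. -/
def parAmplitude (par : V → Option V) (r : V) (i : Fin n) : MvPowerSeries (Fin n) R :=
  ∑ p : (V → Fin n) × (V → Fin n), if p.2 r = i then indexTerm F par p.1 p.2 else 0

theorem sum_children_single_eq_zero_iff (par : V → Option V) (b : V → Fin n) (x : V) :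
    ∑ y with par y = some x, Finsupp.single (b y) 1 = (0 : Fin n →₀ ℕ) ↔
      ¬ ∃ y, par y = some x := by
  simp [Finset.sum_eq_zero_iff]

namespace Feynman.IsPresentation

variable {E : Type*} [Fintype E] [DecidableEq E] {D : Feynman (Fin 1) Empty E}
  {par : V → Option V} {f : V ⊕ V ≃ E} (h : D.IsPresentation par f)
include h

theorem prod_ubar {M : Type*} [CommMonoid M] (g : {e // e ∈ D.Eubar} → M) :
    ∏ e, g e = ∏ x, g ⟨f (.inl x), h.inl_mem x⟩ := by
  let ubar (x : V) : {e // e ∈ D.Eubar} := ⟨f (.inl x), h.inl_mem x⟩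
  have hubar : Function.Bijective ubar := by
    refine ⟨fun x y hxy => ?_, fun ⟨e, he⟩ => ?_⟩
    · exact Sum.inl_injective (f.injective (Subtype.ext_iff.1 hxy))
    · obtain ⟨x | x, rfl⟩ := f.surjective e
      · exact ⟨x, rfl⟩
      · exact absurd he (h.inr_notMem x)
  exact (hubar.prod_comp g).symm

theorem prod_piH_mul_prod_piY (α : E → Fin n) :
    (∏ B ∈ D.piH, C (D.hVertex F α B)) * ∏ B ∈ D.piY, D.yVertex R α B =
      ∏ x, vertexFactor F (α (f (.inl x)))
        (∑ y with par y = some x, Finsupp.single (α (f (.inr y))) 1) := by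
  rw [h.piH_eq, h.piY_eq, Finset.prod_image block_injective.injOn,
    Finset.prod_image block_injective.injOn,
    ← Finset.prod_filter_mul_prod_filter_not univ (fun x => ∃ y, par y = some x)]
  congr 1
  · refine Finset.prod_congr rfl fun x hx => ?_
    rw [vertexFactor, if_neg, hVertex, h.block_inter_Eubar, Finset.prod_singleton,
      h.block_inter_Eu, Finset.sum_map]
    · rfl
    · rw [sum_children_single_eq_zero_iff, not_not]
      exact (Finset.mem_filter.1 hx).2
  · refine Finset.prod_congr rfl fun x hx => ?_
    rw [vertexFactor, if_pos, yVertex, h.block_inter_Eubar, Finset.prod_singleton]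
    rw [sum_children_single_eq_zero_iff]
    exact (Finset.mem_filter.1 hx).2

theorem isAttribution_iff {r : V} (hr : par r = none) (i : Fin n) (α : E → Fin n) :
    D.IsAttribution (fun _ => i) Empty.elim α ↔ α (f (.inr r)) = i := by
  simp [IsAttribution, (h.root r).2 hr]

theorem amplitude_eq {r : V} (hr : par r = none) (i : Fin n) :
    D.amplitude F (fun _ => i) Empty.elim = parAmplitude F par r i := by
  rw [amplitude, Finset.sum_filter]
  refine Fintype.sum_equiv ((Equiv.arrowCongr f.symm (Equiv.refl (Fin n))).trans
    (Equiv.sumArrowEquivProdArrow V V (Fin n))) _ _ fun α => ?_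
  simp only [h.isAttribution_iff hr, h.prod_ubar, h.contr, mul_assoc, h.prod_piH_mul_prod_piY]
  rfl

end Feynman.IsPresentation

end Amplitude

/-! ### The vertices of a planar tree -/

theorem sum_mul_prod_sum_ite {ι κ S : Type*} [Fintype ι] [DecidableEq ι] [Fintype κ]
    [DecidableEq κ] [CommSemiring S] {X : ι → Type*} [∀ k, Fintype (X k)] (φ : (ι → κ) → S)
    (g : ∀ k, X k → κ) (ψ : ∀ k, X k → S) :
    ∑ ks : ι → κ, φ ks * ∏ k, ∑ q, (if g k q = ks k then ψ k q else 0) =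
      ∑ q : ∀ k, X k, φ (fun k => g k (q k)) * ∏ k, ψ k (q k) := by
  simp only [Finset.prod_univ_sum, Fintype.piFinset_univ, Finset.mul_sum]
  rw [Finset.sum_comm]
  refine Finset.sum_congr rfl fun q _ => ?_
  rw [Fintype.sum_eq_single fun k => g k (q k)]
  · simp
  · intro ks hks
    obtain ⟨k, hk⟩ := Function.ne_iff.1 hks
    rw [Finset.prod_eq_zero (Finset.mem_univ k) (if_neg hk.symm), mul_zero]

namespace PTree

/-- The vertices of a planar tree: the root and the vertices of the branches. -/
def Vertex : PTree → Type
  | mk d branch => Option (Σ k : Fin d, Vertex (branch k))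

instance instFintypeVertex : (t : PTree) → Fintype t.Vertex
  | mk d branch =>
    letI : ∀ k, Fintype (branch k).Vertex := fun k => instFintypeVertex (branch k)
    inferInstanceAs (Fintype (Option (Σ k : Fin d, (branch k).Vertex)))

instance instDecidableEqVertex : (t : PTree) → DecidableEq t.Vertex
  | mk d branch =>
    letI : ∀ k, DecidableEq (branch k).Vertex := fun k => instDecidableEqVertex (branch k)
    inferInstanceAs (DecidableEq (Option (Σ k : Fin d, (branch k).Vertex)))

/-- The root of a planar tree. -/
def root : (t : PTree) → t.Vertex
  | mk _ _ => none

/-- The inclusion of the vertices of the `k`-th branch. -/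
def embed {d : {d : ℕ // d ≠ 1}} (branch : Fin d → PTree) (k : Fin d) (x : (branch k).Vertex) :
    (mk d branch).Vertex :=
  some ⟨k, x⟩

/-- The parent map of a planar tree. -/
def parent : (t : PTree) → t.Vertex → Option t.Vertex
  | mk _ _, none => none
  | mk d branch, some ⟨k, x⟩ =>
    some (((branch k).parent x).elim (mk d branch).root (embed branch k))

section Branches

variable {d : {d : ℕ // d ≠ 1}} (branch : Fin d → PTree)

theorem eq_root_or_eq_embed (x : (mk d branch).Vertex) :
    x = (mk d branch).root ∨ ∃ k y, x = embed branch k y := by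
  cases x with
  | none => exact Or.inl rfl
  | some p => exact Or.inr ⟨p.1, p.2, rfl⟩

theorem embed_ne_root (k : Fin d) (x : (branch k).Vertex) :
    embed branch k x ≠ (mk d branch).root := nofun

theorem embed_injective (k : Fin d) : Function.Injective (embed branch k) := by
  rintro x _ ⟨⟩
  rfl

theorem embed_ne_embed {k k' : Fin d} (hk : k ≠ k') (x : (branch k).Vertex)
    (y : (branch k').Vertex) : embed branch k x ≠ embed branch k' y := by
  rintro ⟨⟩
  exact hk rfl

theorem parent_root : (mk d branch).parent (mk d branch).root = none := rfl

theorem parent_embed (k : Fin d) (x : (branch k).Vertex) : (mk d branch).parent (embed branch k x) =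
    some (((branch k).parent x).elim (mk d branch).root (embed branch k)) := rfl

theorem prod_vertex {M : Type*} [CommMonoid M] (f : (mk d branch).Vertex → M) :
    ∏ x, f x = f (mk d branch).root * ∏ k, ∏ x, f (embed branch k x) := by
  rw [← Fintype.prod_sigma' fun k x => f (embed branch k x)]
  exact Fintype.prod_option (α := Σ k : Fin d, (branch k).Vertex) f

theorem sum_vertex {M : Type*} [AddCommMonoid M] (f : (mk d branch).Vertex → M) :
    ∑ x, f x = f (mk d branch).root + ∑ k, ∑ x, f (embed branch k x) := by
  rw [← Fintype.sum_sigma' fun k x => f (embed branch k x)]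
  exact Fintype.sum_option (α := Σ k : Fin d, (branch k).Vertex) f

end Branches

theorem parent_eq_none_iff (t : PTree) (x : t.Vertex) : t.parent x = none ↔ x = t.root := by
  obtain ⟨d, branch⟩ := t
  rcases eq_root_or_eq_embed branch x with rfl | ⟨k, y, rfl⟩
  · simp [parent_root]
  · simp [parent_embed, embed_ne_root]

section Branches

variable {d : {d : ℕ // d ≠ 1}} (branch : Fin d → PTree)

theorem parent_embed_eq_root_iff (k : Fin d) (x : (branch k).Vertex) :
    (mk d branch).parent (embed branch k x) = some (mk d branch).root ↔ x = (branch k).root := by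
  rw [parent_embed, Option.some_inj, ← (branch k).parent_eq_none_iff x]
  cases (branch k).parent x with
  | none => simp
  | some y => simp [embed_ne_root]

theorem parent_embed_eq_embed_iff (k : Fin d) (x y : (branch k).Vertex) :
    (mk d branch).parent (embed branch k x) = some (embed branch k y) ↔
      (branch k).parent x = some y := by
  rw [parent_embed, Option.some_inj]
  cases (branch k).parent x with
  | none => simp [(embed_ne_root branch k y).symm]
  | some z => simp [(embed_injective branch k).eq_iff]

theorem parent_embed_ne_embed {k k' : Fin d} (hk : k ≠ k') (x : (branch k).Vertex)
    (y : (branch k').Vertex) :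
    (mk d branch).parent (embed branch k x) ≠ some (embed branch k' y) := by
  rw [parent_embed, ne_eq, Option.some_inj]
  cases (branch k).parent x with
  | none => exact (embed_ne_root branch k' y).symm
  | some z => exact embed_ne_embed branch hk z y

theorem sum_children_root {M : Type*} [AddCommMonoid M] (f : (mk d branch).Vertex → M) :
    ∑ y with (mk d branch).parent y = some (mk d branch).root, f y =
      ∑ k, f (embed branch k (branch k).root) := by
  rw [Finset.sum_filter, sum_vertex, parent_root]
  simp [parent_embed_eq_root_iff]

theorem sum_children_embed {M : Type*} [AddCommMonoid M] (f : (mk d branch).Vertex → M) (k : Fin d)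
    (x : (branch k).Vertex) :
    ∑ y with (mk d branch).parent y = some (embed branch k x), f y =
      ∑ y with (branch k).parent y = some x, f (embed branch k y) := by
  rw [Finset.sum_filter, Finset.sum_filter, sum_vertex, parent_root, Finset.sum_eq_single k]
  · simp [parent_embed_eq_embed_iff]
  · intro k' _ hk
    exact Finset.sum_eq_zero fun y _ => if_neg (parent_embed_ne_embed branch hk y x)
  · simp

end Branches

theorem card_children_ne_one (t : PTree) (x : t.Vertex) :
    ({y | t.parent y = some x} : Finset t.Vertex).card ≠ 1 := by
  induction t with
  | mk d branch ih =>
    rw [Finset.card_eq_sum_ones]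
    rcases eq_root_or_eq_embed branch x with rfl | ⟨k, y, rfl⟩
    · rw [sum_children_root]
      simpa using d.2
    · rw [sum_children_embed, ← Finset.card_eq_sum_ones]
      exact ih k y

theorem exists_isDepth_parent (t : PTree) : ∃ dep, IsDepth t.parent dep := by
  induction t with
  | mk d branch ih =>
    choose dep dep_none dep_some using ih
    let vertexDepth : (mk d branch).Vertex → ℕ :=
      fun o => Option.elim (α := Σ k : Fin d, (branch k).Vertex) o 1 fun p => dep p.1 (some p.2) + 1
    refine ⟨fun o => o.elim 0 vertexDepth, rfl, fun x => ?_⟩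
    rcases eq_root_or_eq_embed branch x with rfl | ⟨k, y, rfl⟩
    · rfl
    · rw [parent_embed]
      change dep k (some y) + 1 =
        vertexDepth (((branch k).parent y).elim (mk d branch).root (embed branch k)) + 1
      rw [dep_some]
      cases (branch k).parent y with
      | none => rw [dep_none]; rfl
      | some z => rfl

/-! ### The amplitude of a planar tree -/

section Amplitude

variable {n : ℕ} {R : Type*} [CommRing R] (F : Fin n → MvPowerSeries (Fin n) R)
  {d : {d : ℕ // d ≠ 1}} (branch : Fin d → PTree)

theorem indexTerm_mk (a b : (mk d branch).Vertex → Fin n) :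
    indexTerm F (mk d branch).parent a b =
      C ((linMatrix F)⁻¹ (b (mk d branch).root) (a (mk d branch).root)) *
        (vertexFactor F (a (mk d branch).root) (mult fun k => b (embed branch k (branch k).root)) *
        ∏ k, indexTerm F (branch k).parent (a ∘ embed branch k) (b ∘ embed branch k)) := by
  simp only [indexTerm, prod_vertex, sum_children_root, sum_children_embed,
    Finset.prod_mul_distrib, Function.comp_apply]
  rw [mult]
  ring

/-- Functions on a tree, in terms of their values at the root and on the branches. -/
def vertexArrowEquiv (X : Type*) :
    ((mk d branch).Vertex → X) ≃ X × ∀ k, (branch k).Vertex → X where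
  toFun a := (a (mk d branch).root, fun k => a ∘ embed branch k)
  invFun p := fun o => Option.elim (α := Σ k : Fin d, (branch k).Vertex) o p.1 fun q => p.2 q.1 q.2
  left_inv a := by
    ext x
    rcases eq_root_or_eq_embed branch x with rfl | ⟨k, y, rfl⟩ <;> rfl
  right_inv _ := rfl

/-- Pairs of functions on a tree, in terms of their values at the root and on the branches. -/
def vertexArrowProdEquiv (X : Type*) : ((mk d branch).Vertex → X) × ((mk d branch).Vertex → X) ≃
    X × X × ∀ k, ((branch k).Vertex → X) × ((branch k).Vertex → X) :=
  ((vertexArrowEquiv branch X).prodCongr (vertexArrowEquiv branch X)).trans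
    ((Equiv.prodProdProdComm _ _ _ _).trans
      ((Equiv.prodAssoc _ _ _).trans ((Equiv.refl X).prodCongr
        ((Equiv.refl X).prodCongr (Equiv.arrowProdEquivProdArrow _ _ _).symm))))

theorem parAmplitude_mk (i : Fin n) :
    parAmplitude F (mk d branch).parent (mk d branch).root i =
      ∑ l, C ((linMatrix F)⁻¹ i l) * ∑ ks : Fin d → Fin n, vertexFactor F l (mult ks) *
        ∏ k, parAmplitude F (branch k).parent (branch k).root (ks k) := by
  calc
    _ = ∑ q : Fin n × Fin n × ∀ k, ((branch k).Vertex → Fin n) × ((branch k).Vertex → Fin n),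
          if q.2.1 = i then C ((linMatrix F)⁻¹ q.2.1 q.1) *
            (vertexFactor F q.1 (mult fun k => (q.2.2 k).2 (branch k).root) *
              ∏ k, indexTerm F (branch k).parent (q.2.2 k).1 (q.2.2 k).2) else 0 := by
      refine Fintype.sum_equiv (vertexArrowProdEquiv branch (Fin n)) _ _ fun p => ?_
      rw [indexTerm_mk]
      rfl
    _ = _ := by
      simp only [parAmplitude, sum_mul_prod_sum_ite]
      simp only [Fintype.sum_prod_type, Finset.mul_sum]
      refine Finset.sum_congr rfl fun l _ => ?_
      rw [Finset.sum_comm]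
      simp

theorem parAmplitude_eq_amp (t : PTree) (i : Fin n) :
    parAmplitude F t.parent t.root i = t.amp F i := by
  induction t generalizing i with
  | mk d branch ih => simp only [parAmplitude_mk, ih, amp]

end Amplitude

end PTree

/-! ### Coverings by planar trees -/

namespace PTree

variable {d : {d : ℕ // d ≠ 1}} (branch : Fin d → PTree)

theorem children_root : {y | (mk d branch).parent y = some (mk d branch).root} =
    (fun k => embed branch k (branch k).root) '' Set.univ := by
  ext y
  rcases eq_root_or_eq_embed branch y with rfl | ⟨k, y, rfl⟩
  · simp [parent_root, embed_ne_root]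
  · rw [Set.mem_ofPred_eq, parent_embed_eq_root_iff]
    refine ⟨fun hy => ⟨k, trivial, hy ▸ rfl⟩, ?_⟩
    rintro ⟨_, -, ⟨⟩⟩
    rfl

theorem children_embed (k : Fin d) (x : (branch k).Vertex) :
    {y | (mk d branch).parent y = some (embed branch k x)} =
      embed branch k '' {y | (branch k).parent y = some x} := by
  ext y
  rw [Set.mem_ofPred_eq]
  refine ⟨fun hy => ?_, ?_⟩
  · rcases eq_root_or_eq_embed branch y with rfl | ⟨k', y, rfl⟩
    · cases hy
    obtain rfl : k' = k := by_contra fun hk => parent_embed_ne_embed branch hk y x hy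
    exact ⟨y, (parent_embed_eq_embed_iff branch k' y x).1 hy, rfl⟩
  · rintro ⟨y, hy, rfl⟩
    exact (parent_embed_eq_embed_iff branch k y x).2 hy

theorem embed_branch_root_injective :
    Function.Injective fun k => embed branch k (branch k).root := fun _ _ h =>
  by_contra fun hk => embed_ne_embed branch hk _ _ h

end PTree

theorem bijOn_univ_iff_exists_equiv {α β : Type*} {g : α → β} {s : Set β} :
    Set.BijOn g Set.univ s ↔ ∃ σ : α ≃ s, ∀ a, g a = σ a := by
  refine ⟨fun h => ⟨(Equiv.Set.univ α).symm.trans (h.equiv g), fun _ => rfl⟩, ?_⟩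
  rintro ⟨σ, hσ⟩
  obtain rfl : g = Subtype.val ∘ σ := funext hσ
  exact ⟨fun a _ => (σ a).2, (Subtype.val_injective.comp σ.injective).injOn,
    fun b hb => ⟨σ.symm ⟨b, hb⟩, trivial, by simp⟩⟩

section Covering

open PTree

variable {V : Type*}

/-- The map `e` sends the root of the planar tree `t` to `v` and is, at every vertex, a bijection
onto the children of its image. -/
structure IsCovering (t : PTree) (par : V → Option V) (v : V) (e : t.Vertex → V) : Prop where
  root : e t.root = v
  bijOn : ∀ x, Set.BijOn e {y | t.parent y = some x} {y | par y = some (e x)}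

/-- The coverings of the descendants of `v` by the planar tree `t`. -/
def Covering (t : PTree) (par : V → Option V) (v : V) : Type _ :=
  {e : t.Vertex → V // IsCovering t par v e}

instance [Finite V] (t : PTree) (par : V → Option V) (v : V) : Finite (Covering t par v) :=
  Subtype.finite

variable {par : V → Option V}

namespace IsCovering

variable {t : PTree} {r : V} {e : t.Vertex → V}

theorem parent_map (h : IsCovering t par r e) (hr : par r = none) (x : t.Vertex) :
    par (e x) = (t.parent x).map e := by
  cases hx : t.parent x with
  | none => rw [(t.parent_eq_none_iff x).1 hx, h.root, hr, Option.map_none]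
  | some z => exact (h.bijOn z).mapsTo hx

theorem injective (h : IsCovering t par r e) (hr : par r = none) : Function.Injective e := by
  obtain ⟨dep, hdep⟩ := t.exists_isDepth_parent
  intro x
  induction x using hdep.induction_parent with
  | step x ih =>
    intro y hxy
    have hparent := h.parent_map hr x
    rw [hxy, h.parent_map hr y] at hparent
    cases hx : t.parent x with
    | none =>
      rw [hx, Option.map_none, Option.map_eq_none_iff] at hparent
      rw [(t.parent_eq_none_iff x).1 hx, (t.parent_eq_none_iff y).1 hparent]
    | some z =>
      rw [hx, Option.map_some, Option.map_eq_some_iff] at hparent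
      obtain ⟨z', hz', hzz'⟩ := hparent
      obtain rfl := ih z hx hzz'.symm
      exact (h.bijOn z).injOn hx hz' hxy

theorem surjective (h : IsCovering t par r e) {dep : Option V → ℕ} (hdep : IsDepth par dep)
    (hr : ∀ x, par x = none ↔ x = r) : Function.Surjective e := by
  intro v
  induction v using hdep.induction_parent with
  | step v ih =>
    cases hv : par v with
    | none => exact ⟨t.root, h.root.trans ((hr v).1 hv).symm⟩
    | some w =>
      obtain ⟨z, rfl⟩ := ih w hv
      obtain ⟨y, -, hy⟩ := (h.bijOn z).surjOn hv
      exact ⟨y, hy⟩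

end IsCovering

theorem isCovering_of_parent_map {t : PTree} {r : V} (hr : ∀ x, par x = none ↔ x = r)
    (e : t.Vertex ≃ V) (he : ∀ x, par (e x) = (t.parent x).map e) : IsCovering t par r e where
  root := by rw [← hr, he, (t.parent_eq_none_iff _).2 rfl, Option.map_none]
  bijOn _ := e.bijOn fun _ => parent_map_eq_some_iff he

theorem card_covering {dep : Option V → ℕ} (hdep : IsDepth par dep) {r : V}
    (hr : ∀ x, par x = none ↔ x = r) (t : PTree) : Nat.card (Covering t par r) =
      Nat.card {e : t.Vertex ≃ V // ∀ x, par (e x) = (t.parent x).map e} := by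
  have hroot : par r = none := (hr r).2 rfl
  exact Nat.card_congr
    { toFun := fun e => ⟨.ofBijective e.1 ⟨e.2.injective hroot, e.2.surjective hdep hr⟩,
        e.2.parent_map hroot⟩
      invFun := fun e => ⟨e.1, isCovering_of_parent_map hr e.1 e.2⟩
      left_inv := fun _ => rfl
      right_inv := fun _ => Subtype.ext (Equiv.ext fun _ => rfl) }

variable {d : {d : ℕ // d ≠ 1}} (branch : Fin d → PTree)

theorem isCovering_mk_iff {v : V} {e : (mk d branch).Vertex → V} :
    IsCovering (mk d branch) par v e ↔ e (mk d branch).root = v ∧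
      ∃ σ : Fin d ≃ {y // par y = some v}, ∀ k, IsCovering (branch k) par (σ k)
        (e ∘ embed branch k) := by
  have bijOn_root : Set.BijOn e {y | (mk d branch).parent y = some (mk d branch).root}
      {y | par y = some v} ↔ ∃ σ : Fin d ≃ {y // par y = some v},
        ∀ k, e (embed branch k (branch k).root) = σ k := by
    rw [children_root, ← Set.bijOn_comp_iff (embed_branch_root_injective branch).injOn,
      bijOn_univ_iff_exists_equiv]
    rfl
  have bijOn_embed (k x) : Set.BijOn e {y | (mk d branch).parent y = some (embed branch k x)}
      {y | par y = some (e (embed branch k x))} ↔ Set.BijOn (e ∘ embed branch k)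
        {y | (branch k).parent y = some x} {y | par y = some ((e ∘ embed branch k) x)} := by
    rw [children_embed, ← Set.bijOn_comp_iff (embed_injective branch k).injOn]
    rfl
  constructor
  · rintro ⟨rfl, hbij⟩
    obtain ⟨σ, hσ⟩ := bijOn_root.1 (hbij _)
    exact ⟨rfl, σ, fun k => ⟨hσ k, fun x => (bijOn_embed k x).1 (hbij _)⟩⟩
  · rintro ⟨rfl, σ, hσ⟩
    refine ⟨rfl, fun x => ?_⟩
    rcases eq_root_or_eq_embed branch x with rfl | ⟨k, x, rfl⟩
    · exact bijOn_root.2 ⟨σ, fun k => (hσ k).root⟩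
    · exact (bijOn_embed k x).2 ((hσ k).bijOn x)

/-- The covering of the descendants of `v` obtained from a matching of the branches with the
children of `v` and a covering of the descendants of each child. -/
def Covering.glue {v : V}
    (p : Σ σ : Fin d ≃ {y // par y = some v}, ∀ k, Covering (branch k) par (σ k)) :
    Covering (mk d branch) par v :=
  ⟨(vertexArrowEquiv branch V).symm (v, fun k => (p.2 k).1),
    (isCovering_mk_iff branch).2 ⟨rfl, p.1, fun k => (p.2 k).2⟩⟩

theorem Covering.glue_bijective (v : V) :
    Function.Bijective (Covering.glue (par := par) (v := v) branch) := by
  constructor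
  · rintro ⟨σ, c⟩ ⟨σ', c'⟩ h
    have hc (k) : (c k).1 = (c' k).1 := congrFun (Prod.ext_iff.1
      ((vertexArrowEquiv branch V).symm.injective (Subtype.ext_iff.1 h))).2 k
    obtain rfl : σ = σ' := by
      ext k
      rw [← (c k).2.root, ← (c' k).2.root, hc]
    obtain rfl : c = c' := funext fun k => Subtype.ext (hc k)
    rfl
  · rintro ⟨e, he⟩
    obtain ⟨rfl, σ, hσ⟩ := (isCovering_mk_iff branch).1 he
    exact ⟨⟨σ, fun k => ⟨_, hσ k⟩⟩, Subtype.ext ((vertexArrowEquiv branch V).symm_apply_apply e)⟩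

theorem card_covering_mk [Fintype V] [DecidableEq V] (v : V) :
    Nat.card (Covering (mk d branch) par v) =
      ∑ σ : Fin d ≃ {y // par y = some v}, ∏ k, Nat.card (Covering (branch k) par (σ k)) := by
  rw [← Nat.card_eq_of_bijective _ (Covering.glue_bijective branch v), Nat.card_sigma]
  simp only [Nat.card_pi]

theorem weight_mul_card_covering_mk [Fintype V] [DecidableEq V] (v : V) :
    (mk d branch).weight * Nat.card (Covering (mk d branch) par v) =
      (d.1.factorial : ℚ)⁻¹ * ∑ σ : Fin d ≃ {y // par y = some v},
        ∏ k, (branch k).weight * Nat.card (Covering (branch k) par (σ k)) := by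
  rw [weight, card_covering_mk, mul_assoc]
  push_cast
  simp only [Finset.mul_sum, Finset.prod_mul_distrib]

section Sum

variable {S : Type*} [CommRing S] [Algebra ℚ S] [UniformSpace S] [IsUniformAddGroup S]
  [NonarchimedeanRing S] [Fintype V] [DecidableEq V]

theorem hasSum_weight_mul_card_covering_of_children {v : V}
    (hcard : ({y | par y = some v} : Finset V).card ≠ 1)
    (hchildren : ∀ y, par y = some v → HasSum (fun t : PTree =>
      algebraMap ℚ S (t.weight * Nat.card (Covering t par y))) 1) :
    HasSum (fun t : PTree => algebraMap ℚ S (t.weight * Nat.card (Covering t par v))) 1 := by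
  rw [← Fintype.card_subtype] at hcard
  obtain ⟨d, hd⟩ : ∃ d : {d : ℕ // d ≠ 1}, d.1 = Fintype.card {y // par y = some v} :=
    ⟨⟨_, hcard⟩, rfl⟩
  have card_equiv : (Fintype.card (Fin d ≃ {y // par y = some v}) : ℚ) = d.1.factorial := by
    rw [Fintype.card_equiv (Fintype.equivOfCardEq (by simp [hd])), Fintype.card_fin]
  rw [← equivSigma.hasSum_iff, ← (sigma_mk_injective (i := d)).hasSum_iff]
  · have hasSum_prod (σ : Fin d ≃ {y // par y = some v}) : HasSum (fun branch : Fin d → PTree =>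
        ∏ k, algebraMap ℚ S ((branch k).weight * Nat.card (Covering (branch k) par (σ k))))
        (∏ _k : Fin d, 1) :=
      hasSum_prod_pi (a := fun _ => 1) (f := fun k (t : PTree) =>
        algebraMap ℚ S (t.weight * Nat.card (Covering t par (σ k))))
        fun k => hchildren (σ k) (σ k).2
    have hasSum_arity := (hasSum_sum (s := univ) fun σ _ => hasSum_prod σ).mul_left
      (algebraMap ℚ S (d.1.factorial : ℚ)⁻¹)
    rw [prod_const_one, sum_const, card_univ, nsmul_one, ← map_natCast (algebraMap ℚ S),
      ← map_mul, card_equiv, inv_mul_cancel₀ (by positivity), map_one] at hasSum_arity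
    refine hasSum_arity.congr_fun fun branch => ?_
    simp only [← map_prod, ← map_sum, ← map_mul]
    exact congrArg _ (weight_mul_card_covering_mk branch v)
  · rintro ⟨d', branch⟩ hd'
    have : IsEmpty (Fin d' ≃ {y // par y = some v}) := by
      refine ⟨fun σ => hd' ?_⟩
      obtain rfl : d' = d := Subtype.ext (by simpa [hd] using Fintype.card_congr σ)
      exact ⟨branch, rfl⟩
    change algebraMap ℚ S ((mk d' branch).weight * Nat.card (Covering (mk d' branch) par v)) = 0
    rw [weight_mul_card_covering_mk, Fintype.sum_empty, mul_zero, map_zero]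

theorem hasSum_weight_mul_card_covering {dep : Option V → ℕ} (hdep : IsDepth par dep)
    (hcard : ∀ x, ({y | par y = some x} : Finset V).card ≠ 1) (v : V) :
    HasSum (fun t : PTree => algebraMap ℚ S (t.weight * Nat.card (Covering t par v))) 1 := by
  induction v using hdep.induction_children with
  | step v ih => exact hasSum_weight_mul_card_covering_of_children (hcard v) ih

end Sum

end Covering

/-! ### The sum over isomorphism classes -/

namespace Feynman

variable {I J E E' : Type*} [Fintype E] [DecidableEq E] [Fintype E'] [DecidableEq E']

theorem IsIso.card_isIso {D : Feynman I J E} {D' : Feynman I J E'} {σ : E ≃ E'}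
    (h : D.IsIso D' σ) : Nat.card {σ : E ≃ E' // D.IsIso D' σ} = D'.autCard :=
  Nat.card_congr
    { toFun := fun s => ⟨σ.symm.trans s.1, h.symm.trans s.2⟩
      invFun := fun s => ⟨σ.trans s.1, h.trans s.2⟩
      left_inv := fun s => by ext; simp
      right_inv := fun s => by ext; simp }

theorem autCard_pos (D : Feynman I J E) : 0 < D.autCard :=
  have : Nonempty {σ : E ≃ E // D.IsIso D σ} := ⟨⟨_, IsIso.refl D⟩⟩
  Nat.card_pos

end Feynman

namespace PTree

/-- The Feynman diagram of a planar tree: the half-lines are two copies of its vertices, the `ū`-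
and the `u`-end of the line from each vertex to its parent, or to the source for the root. -/
def diagram (t : PTree) : Feynman (Fin 1) Empty (Fin (Fintype.card (t.Vertex ⊕ t.Vertex))) :=
  .ofParent t.parent (Fintype.equivFin _) t.parent_eq_none_iff t.card_children_ne_one

theorem isPresentation_diagram (t : PTree) :
    t.diagram.IsPresentation t.parent (Fintype.equivFin _) :=
  Feynman.isPresentation_ofParent _ _ _ _

/-- The isomorphism class of the diagram of a planar tree. -/
def toClass (t : PTree) : ConnClass (Fin 1) Empty :=
  Quotient.mk _ ⟨_, t.diagram,
    t.isPresentation_diagram.exists_isDepth_iff_connected.1 t.exists_isDepth_parent⟩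

theorem toClass_eq_mk_iff (t : PTree) (D : ConnDiagram (Fin 1) Empty) :
    t.toClass = Quotient.mk _ D ↔ ∃ σ, t.diagram.IsIso D.2.1 σ :=
  Quotient.eq

theorem amplitude_diagram {n : ℕ} {R : Type*} [CommRing R] (F : Fin n → MvPowerSeries (Fin n) R)
    (t : PTree) (i : Fin n) :
    t.diagram.amplitude F (fun _ => i) (Empty.elim : Empty → Fin n) = t.amp F i := by
  rw [t.isPresentation_diagram.amplitude_eq F ((t.parent_eq_none_iff _).2 rfl),
    t.parAmplitude_eq_amp]

end PTree

section ConnTerm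

variable {n : ℕ} {R : Type*} [CommRing R] [Algebra ℚ R] [UniformSpace R] [DiscreteUniformity R]
  (F : Fin n → MvPowerSeries (Fin n) R)

/-- The class of `D` is covered by its planar trees with total weight `1 / #Aut D`, since the
isomorphisms from the diagram of `t` to `D` are the coverings of the root of `D` by `t`. -/
theorem hasSum_fiber (i : Fin n) (c : ConnClass (Fin 1) Empty) :
    HasSum (fun t : {t : PTree // t.toClass = c} => t.1.weight • t.1.amp F i)
      (connTerm F (fun _ : Fin 1 => i) (Empty.elim : Empty → Fin n) c) := by
  induction c using Quotient.inductionOn with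
  | _ D =>
  obtain ⟨m, D, hD⟩ := D
  have h := D.isPresentation_parent
  obtain ⟨dep, hdep⟩ := h.exists_isDepth_iff_connected.2 hD
  obtain ⟨r, hr, hr_unique⟩ := h.existsUnique_root
  have card_covering_root (t : PTree) :
      Nat.card (Covering t D.parent r) = Nat.card {σ // t.diagram.IsIso D σ} := by
    rw [card_covering hdep fun x => ⟨hr_unique x, fun hx => hx ▸ hr⟩,
      ← t.isPresentation_diagram.card_isIso h]
  have hsum := (hasSum_weight_mul_card_covering (S := MvPowerSeries (Fin n) R) hdep
    h.card_children_ne_one r).mul_right ((D.autCard : ℚ)⁻¹ • D.amplitude F (fun _ => i) Empty.elim)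
  rw [one_mul, ← (Subtype.val_injective (p := fun t : PTree => t.toClass = _)).hasSum_iff] at hsum
  · refine hsum.congr_fun ?_
    rintro ⟨t, ht⟩
    obtain ⟨σ, hσ⟩ := (t.toClass_eq_mk_iff _).1 ht
    have autCard_ne_zero : (D.autCard : ℚ) ≠ 0 := by exact_mod_cast D.autCard_pos.ne'
    rw [Function.comp_apply, card_covering_root, hσ.card_isIso, ← Algebra.smul_def, smul_smul,
      mul_assoc, mul_inv_cancel₀ autCard_ne_zero, mul_one, ← hσ.amplitude_eq, t.amplitude_diagram]
  · intro t ht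
    have : IsEmpty {σ // t.diagram.IsIso D σ} :=
      ⟨fun σ => ht ⟨⟨t, (t.toClass_eq_mk_iff _).2 ⟨σ.1, σ.2⟩⟩, rfl⟩⟩
    rw [card_covering_root, Nat.card_of_isEmpty, Nat.cast_zero, mul_zero, map_zero, zero_mul]

theorem hasSum_connTerm (i : Fin n) :
    HasSum (connTerm F (fun _ : Fin 1 => i) (Empty.elim : Empty → Fin n)) (treeSeries F i) := by
  have h := hasSum_treeSeries F i
  rw [← (Equiv.sigmaFiberEquiv PTree.toClass).hasSum_iff] at h
  exact h.sigma fun c => hasSum_fiber F i c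

end ConnTerm

end FeynRev

end

theorem corollary1 {n : ℕ} {R : Type*} [CommRing R] [Algebra ℚ R]
    (F : Fin n → MvPowerSeries (Fin n) R)
    (hF : ∀ i, MvPowerSeries.constantCoeff (F i) = 0)
    (hA : IsUnit (FeynRev.linMatrix F)) (i : Fin n) :
    FeynRev.GaussIntegrable (FeynRev.linMatrix F)
        (MvPowerSeries.X (FeynRev.uVar i) * FeynRev.expInteraction F) ∧
    FeynRev.GaussIntegrable (FeynRev.linMatrix F) (FeynRev.expInteraction F) ∧
    IsUnit (FeynRev.gaussIntegral (FeynRev.linMatrix F) (FeynRev.expInteraction F)) ∧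
    FeynRev.SummableFamily
      (FeynRev.connTerm F (fun _ : Fin 1 => i) (Empty.elim : Empty → Fin n)) ∧
    FeynRev.gaussIntegral (FeynRev.linMatrix F)
        (MvPowerSeries.X (FeynRev.uVar i) * FeynRev.expInteraction F) *
      Ring.inverse (FeynRev.gaussIntegral (FeynRev.linMatrix F) (FeynRev.expInteraction F)) =
      FeynRev.connCorrelation F (fun _ : Fin 1 => i) (Empty.elim : Empty → Fin n) ∧
    ∀ (E : Type) [Fintype E] [DecidableEq E] (D : FeynRev.Feynman (Fin 1) Empty E),
      D.Connected → D.TreeLike ∧ D.LeavesAreY := by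
  let _ : UniformSpace R := ⊥
  have _ : DiscreteUniformity R := ⟨rfl⟩
  have gaussIntegrable (m : Fin n →₀ ℕ) := FeynRev.gaussIntegrable_monomial_mul
    (A := FeynRev.linMatrix F) (FeynRev.expInteraction_mem F) m 1
  have isUnit_moment_zero := FeynRev.isUnit_moment_zero F hA
  have moment_single_eq := FeynRev.moment_single_eq (FeynRev.constantCoeff_treeSeries F)
    (FeynRev.treeSeries_eq F) i
  have hasSum_connTerm := FeynRev.hasSum_connTerm F i
  rw [← FeynRev.moment_zero, ← FeynRev.moment_single]
  refine ⟨?_, ?_, isUnit_moment_zero, FeynRev.summableFamily_of_hasSum hasSum_connTerm, ?_,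
    fun E _ _ D hD => ⟨hD.treeLike, D.leavesAreY⟩⟩
  · simpa only [FeynRev.monomial_uExponent_single] using gaussIntegrable (Finsupp.single i 1)
  · simpa only [FeynRev.monomial_uExponent_zero, one_mul] using gaussIntegrable 0
  · rw [moment_single_eq, Ring.mul_inverse_cancel_right _ _ isUnit_moment_zero,
      FeynRev.connCorrelation, FeynRev.familySum_eq_of_hasSum hasSum_connTerm]
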